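/- Let $\alpha\in(0,1)$ and $T>0$. A temporal mesh is a finite set of nodes $0=t_0<t_1<\dots<t_M=T$; put $\tau:=t_1$ and $\tau_j:=t_j-t_{j-1}$. For a real grid function $\{U^j\}_{j=0}^M$ the L1 discrete Caputo operator is $$\delta_t^\alpha U^m:=\frac1{\Gamma(1-\alpha)}\sum_{j=1}^m\frac{U^j-U^{j-1}}{t_j-t_{j-1}}\int_{t_{j-1}}^{t_j}(t_m-s)^{-\alpha}\,ds,\qquad m=1,\dots,M.$$ For $\gamma\in\mathbb R$ put $$\mathcal V^j:=\tau t_j^{\alpha-1}\cdot\begin{cases}1&\text{if }\gamma>0,\\ 1+\ln(t_j/\tau)&\text{if }\gamma=0,\\ (\tau/t_j)^\gamma&\text{if }\gamma<0.\end{cases}$$ We say that a mesh has the stability property with constant $C$ if, for all real $\{V^j\}_{j=0}^M$ with $V^0=0$ and all $K\ge0$, $$|\delta_t^\alpha V^j|\le K(\tau/t_j)^{\gamma+1}\ \ (j=1,\dots,M)\quad\Longrightarrow\quad |V^j|\le C\,K\,\mathcal V^j\ \ (j=1,\dots,M).$$ Given $r\ge1$ and $c>0$, a mesh is called quasi-graded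 if $$c^{-1}M^{-r}\le\tau\le cM^{-r},\qquad c^{-1}\tau j^r\le t_j\le c\,\tau j^r,\qquad c^{-1}\tau^{1/r}t_j^{1-1/r}\le\tau_j\le c\,\tau^{1/r}t_j^{1-1/r}\qquad(j=1,\dots,M).$$ **Theorem 2.1 (Stability).** (i) Let $1\le r\le(2-\alpha)/\alpha$, $c>0$ and $\gamma\in\mathbb R$. There is a constant $C$, depending only on $\alpha,T,\gamma,r,c$ (and not on $M$ or on the mesh), such that every mesh that is quasi-graded with parameters $r,c$ has the stability property with constant $C$. (ii) Let $\gamma\le\alpha-1$. There is a constant $C$, depending only on $\alpha,T,\gamma$, such that every temporal mesh has the stability property with constant $C$. (iii) The same statements hold if in the stability property the hypothesis $|\delta_t^\alpha V^j|\le K(\tau/t_j)^{\gamma+1}$ is replaced by $\delta_t^\alpha|V^j|\le K(\tau/t_j)^{\gamma+1}$, where $\delta_t^\alpha$ is applied to the grid function $\{|V^j|\}$. Moreover, for $1\le r\le(2-\alpha)/\alpha$, $c>0$ and $\gamma\in\mathbb R$, the conclusions of (i) and (iii) also hold, with a constant depending only on $\alpha,T,\gamma,r,c$, (a) on every mesh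 $\{t'_k\}_{k=0}^{M'}$ of $[0,T]$ that is obtained by adding arbitrarily many nodes to a mesh $\{t_j\}_{j=0}^M$ that is quasi-graded with parameters $r,c$, provided that the first interval is unchanged, $t'_1=t_1$; (b) on every mesh that satisfies only $c^{-1}M^{-r}\le\tau\le cM^{-r}$ and $\tau_j\le c\,\tau^{1/r}t_j^{1-1/r}$ for $j=1,\dots,M$. -/

import Mathlib

/-- `t 0, …, t M` are the nodes of a temporal mesh `0 = t 0 < t 1 < … < t M = T` on `[0, T]`
(the values `t j` with `j > M` are irrelevant). -/
structure IsTemporalMesh (T : ℝ) (M : ℕ) (t : ℕ → ℝ) : Prop where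
  zero : t 0 = 0
  last : t M = T
  lt_succ : ∀ j < M, t j < t (j + 1)

/-- The L1 discrete Caputo operator `δ_t^α` on the mesh `t`, applied to the grid function `U`
and evaluated at the node `t m`. -/
noncomputable def l1Caputo (α : ℝ) (t U : ℕ → ℝ) (m : ℕ) : ℝ :=
  1 / Real.Gamma (1 - α) *
    ∑ j ∈ Finset.Icc 1 m,
      (U j - U (j - 1)) / (t j - t (j - 1)) * ∫ s in t (j - 1)..t j, (t m - s) ^ (-α)

/-- The mesh is quasi-graded with grading exponent `r`: with `τ = t 1`, one has `τ ≃ M ^ (-r)`, and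
`t j ≃ τ * j ^ r`, `t j - t (j - 1) ≃ τ ^ (1 / r) * (t j) ^ (1 - 1 / r)` for `j = 1, …, M`.
All the two-sided bounds hold with the constants `c⁻¹` and `c`. -/
structure IsQuasiGraded (r c : ℝ) (M : ℕ) (t : ℕ → ℝ) : Prop where
  first_ge : c⁻¹ * (M : ℝ) ^ (-r) ≤ t 1
  first_le : t 1 ≤ c * (M : ℝ) ^ (-r)
  node_ge : ∀ j, 1 ≤ j → j ≤ M → c⁻¹ * (t 1 * (j : ℝ) ^ r) ≤ t j
  node_le : ∀ j, 1 ≤ j → j ≤ M → t j ≤ c * (t 1 * (j : ℝ) ^ r)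
  step_ge : ∀ j, 1 ≤ j → j ≤ M →
    c⁻¹ * (t 1 ^ (1 / r) * t j ^ (1 - 1 / r)) ≤ t j - t (j - 1)
  step_le : ∀ j, 1 ≤ j → j ≤ M →
    t j - t (j - 1) ≤ c * (t 1 ^ (1 / r) * t j ^ (1 - 1 / r))

/-- The weaker mesh condition: `τ = t 1 ≃ M ^ (-r)`, and only the upper bound
`t j - t (j - 1) ≲ τ ^ (1 / r) * (t j) ^ (1 - 1 / r)` on the mesh steps. -/
structure IsWeaklyQuasiGraded (r c : ℝ) (M : ℕ) (t : ℕ → ℝ) : Prop where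
  first_ge : c⁻¹ * (M : ℝ) ^ (-r) ≤ t 1
  first_le : t 1 ≤ c * (M : ℝ) ^ (-r)
  step_le : ∀ j, 1 ≤ j → j ≤ M →
    t j - t (j - 1) ≤ c * (t 1 ^ (1 / r) * t j ^ (1 - 1 / r))

/-- The mesh `t' 0, …, t' M'` is obtained from `t 0, …, t M` by adding new nodes, the first mesh
interval being unchanged. -/
structure IsRefinementKeepingFirst (M : ℕ) (t : ℕ → ℝ) (M' : ℕ) (t' : ℕ → ℝ) : Prop where
  first_eq : t' 1 = t 1
  subset : ∀ j ≤ M, ∃ k ≤ M', t' k = t j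

/-- The majorant `𝒱 = τ * s ^ (α - 1) * {1, 1 + ln (s / τ), (τ / s) ^ γ}`, according as
`γ > 0`, `γ = 0`, `γ < 0`. -/
noncomputable def stabilityMajorant (α γ τ s : ℝ) : ℝ :=
  τ * s ^ (α - 1) *
    (if 0 < γ then 1 else if γ = 0 then 1 + Real.log (s / τ) else (τ / s) ^ γ)

/-- The stability property with constant `C`: if `V 0 = 0` and
`|δ_t^α V j| ≤ K * (τ / t j) ^ (γ + 1)` for `j = 1, …, M`, then `|V j| ≤ C * K * 𝒱 j` for
`j = 1, …, M`. -/
def StabilityProperty (α γ C : ℝ) (M : ℕ) (t : ℕ → ℝ) : Prop :=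
  ∀ (V : ℕ → ℝ) (K : ℝ), 0 ≤ K → V 0 = 0 →
    (∀ j, 1 ≤ j → j ≤ M → |l1Caputo α t V j| ≤ K * (t 1 / t j) ^ (γ + 1)) →
    ∀ j, 1 ≤ j → j ≤ M → |V j| ≤ C * K * stabilityMajorant α γ (t 1) (t j)

/-- The variant of the stability property in which the hypothesis is the one-sided bound
`δ_t^α |V| j ≤ K * (τ / t j) ^ (γ + 1)`, with `δ_t^α` applied to the grid function `|V|`. -/
def StabilityPropertyAbs (α γ C : ℝ) (M : ℕ) (t : ℕ → ℝ) : Prop :=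
  ∀ (V : ℕ → ℝ) (K : ℝ), 0 ≤ K → V 0 = 0 →
    (∀ j, 1 ≤ j → j ≤ M → l1Caputo α t (fun i => |V i|) j ≤ K * (t 1 / t j) ^ (γ + 1)) →
    ∀ j, 1 ≤ j → j ≤ M → |V j| ≤ C * K * stabilityMajorant α γ (t 1) (t j)

/-!
Up to the factor `Γ (1 - α)`, the L1 operator at the node `t m` is the sum of the increments of `V`
with weights `l1Weight`, the mean values of the kernel `(t m - s) ^ (-α)` over the mesh intervals.
The weights increase towards `t m`, so a comparison principle holds (`le_of_l1Caputo_le`), and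
both forms of stability follow from a barrier `B` with `δ B ≥ (τ / t) ^ (γ + 1)` and `B ≲ 𝒱`
(`stability_of_barrier`).

On arbitrary meshes with `γ ≤ α - 1`, the increasing function `t ^ (α - 1 - γ)` is a barrier, simply
because every weight is at least `t m ^ (-α)`.

For the graded meshes, only the upper bound on the steps matters, and refinements inherit it
(`IsRefinementKeepingFirst.step_le`). The building block is the profile `s` on `[0, 1]`,
`s ^ (α - 1)` beyond, whose Caputo derivative is computed in closed form: `tailPrim` is an
antiderivative of the kernel times `(s ^ (α - 1))'`. It is at least of order `x ^ (-α - 1)` for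
`x > 1` (`le_profilePrim_self`). Interpolating the profile on the mesh perturbs this, in the
unfavourable direction where the profile is convex, by at most the sum over the intervals of the
oscillation of the slope times the variation `kernelExcess` of the kernel. If the steps are at most
`ε s ^ σ`, where `σ = 1 - 1 / r` for `r = (2 - α) / α`, this sum is at most a small multiple of the
same `x ^ (-α - 1)`: the intervals near `x` contribute the order `x ^ (σ (2 - α) + α - 3)`, and
`σ (2 - α) = 2 - 2 α`. This is where the restriction on `r` enters
(`exists_l1Caputo_profile_ge`).

With kink at `N τ` instead of `1`, a graded mesh has small steps in the above sense as soon as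
`N ≥ N₀`, because `ε` is then a multiple of `N ^ (-1 / r)`. The barrier for a general `γ` is the
superposition of the profiles with kinks at the scales `N = N₀ 2 ^ k`, with coefficients
proportional to `N ^ (α - γ - 1)`. Each of them is at most `(t / (N τ)) ^ (α - 1)`, so their sum at
`t m` is at most `t m ^ (α - 1)` times the sum of `N ^ (-γ)` over the scales up to `t m / τ`, which
gives the three cases of the majorant (`exists_dyadic_sum_le`). Larger scales are not needed, as the
barrier may depend on `m`.
-/

/-! ### The weights of the L1 operator and the comparison principle -/

/-- The mean value of `s ↦ (t m - s) ^ (-α)` over the mesh interval `(t (j - 1), t j)`: the weight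
with which the increment `U j - U (j - 1)` enters `l1Caputo α t U m`, up to `Γ (1 - α)`. -/
noncomputable def l1Weight (α : ℝ) (t : ℕ → ℝ) (m j : ℕ) : ℝ :=
  ((t m - t (j - 1)) ^ (1 - α) - (t m - t j) ^ (1 - α)) / (t j - t (j - 1)) / (1 - α)

theorem integral_sub_rpow_neg {α : ℝ} (hα1 : α < 1) (u v x : ℝ) :
    ∫ s in u..v, (x - s) ^ (-α) = ((x - u) ^ (1 - α) - (x - v) ^ (1 - α)) / (1 - α) := by
  rw [intervalIntegral.integral_comp_sub_left (fun y => y ^ (-α)) x,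
    integral_rpow (Or.inl (by linarith))]
  rw [show -α + 1 = 1 - α by ring]

theorem l1Caputo_eq_sum_weight {α : ℝ} (hα1 : α < 1) (t U : ℕ → ℝ) (m : ℕ) :
    l1Caputo α t U m =
      1 / Real.Gamma (1 - α) * ∑ j ∈ Finset.Icc 1 m, (U j - U (j - 1)) * l1Weight α t m j := by
  unfold l1Caputo l1Weight
  congr 1
  refine Finset.sum_congr rfl fun j _ => ?_
  rw [integral_sub_rpow_neg hα1]
  ring

theorem l1Caputo_sub {α : ℝ} (hα1 : α < 1) (t U V : ℕ → ℝ) (m : ℕ) :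
    l1Caputo α t (fun j => U j - V j) m = l1Caputo α t U m - l1Caputo α t V m := by
  simp only [l1Caputo_eq_sum_weight hα1]
  rw [← mul_sub, ← Finset.sum_sub_distrib]
  congr 1
  exact Finset.sum_congr rfl fun j _ => by ring

theorem l1Caputo_const_mul {α : ℝ} (hα1 : α < 1) (t U : ℕ → ℝ) (a : ℝ) (m : ℕ) :
    l1Caputo α t (fun j => a * U j) m = a * l1Caputo α t U m := by
  simp only [l1Caputo_eq_sum_weight hα1]
  rw [mul_left_comm a, Finset.mul_sum _ _ a]
  congr 1
  exact Finset.sum_congr rfl fun j _ => by ring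

theorem l1Caputo_neg {α : ℝ} (hα1 : α < 1) (t U : ℕ → ℝ) (m : ℕ) :
    l1Caputo α t (fun j => -U j) m = -l1Caputo α t U m := by
  simpa using l1Caputo_const_mul hα1 t U (-1) m

theorem l1Caputo_sum {α : ℝ} (hα1 : α < 1) (t : ℕ → ℝ) {ι : Type*} (s : Finset ι)
    (U : ι → ℕ → ℝ) (m : ℕ) :
    l1Caputo α t (fun j => ∑ i ∈ s, U i j) m = ∑ i ∈ s, l1Caputo α t (U i) m := by
  simp only [l1Caputo_eq_sum_weight hα1]
  rw [← Finset.mul_sum, Finset.sum_comm]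
  congr 1
  refine Finset.sum_congr rfl fun j _ => ?_
  rw [← Finset.sum_sub_distrib, Finset.sum_mul]

/-- The operator scales like a derivative of order `α`. -/
theorem l1Caputo_scale {α : ℝ} (hα1 : α < 1) {a : ℝ} (ha : 0 < a) {t : ℕ → ℝ} {m : ℕ}
    (ht : ∀ j ≤ m, t j ≤ t m) (U : ℕ → ℝ) :
    l1Caputo α (fun j => t j / a) U m = a ^ α * l1Caputo α t U m := by
  simp only [l1Caputo_eq_sum_weight hα1]
  rw [mul_left_comm (a ^ α), Finset.mul_sum _ _ (a ^ α)]
  congr 1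
  refine Finset.sum_congr rfl fun j hj => ?_
  rw [Finset.mem_Icc] at hj
  have h1 : 0 ≤ t m - t (j - 1) := sub_nonneg.2 (ht _ (by omega))
  have h2 : 0 ≤ t m - t j := sub_nonneg.2 (ht _ hj.2)
  have h3 : a ^ (1 - α) = a / a ^ α := by rw [Real.rpow_sub ha, Real.rpow_one]
  have h4 : 0 < a ^ α := Real.rpow_pos_of_pos ha _
  unfold l1Weight
  simp only [← sub_div]
  rw [Real.div_rpow h1 ha.le, Real.div_rpow h2 ha.le, h3]
  field_simp

theorem IsTemporalMesh.lt {T : ℝ} {M : ℕ} {t : ℕ → ℝ} (ht : IsTemporalMesh T M t) {i j : ℕ}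
    (hij : i < j) (hj : j ≤ M) : t i < t j := by
  induction j, hij using Nat.le_induction with
  | base => exact ht.lt_succ i (by omega)
  | succ k hk ih => exact (ih (by omega)).trans (ht.lt_succ k (by omega))

theorem IsTemporalMesh.le {T : ℝ} {M : ℕ} {t : ℕ → ℝ} (ht : IsTemporalMesh T M t) {i j : ℕ}
    (hij : i ≤ j) (hj : j ≤ M) : t i ≤ t j := by
  rcases hij.eq_or_lt with rfl | h
  · exact le_rfl
  · exact (ht.lt h hj).le

theorem IsTemporalMesh.pos {T : ℝ} {M : ℕ} {t : ℕ → ℝ} (ht : IsTemporalMesh T M t) {j : ℕ}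
    (hj1 : 1 ≤ j) (hj : j ≤ M) : 0 < t j := by
  simpa [ht.zero] using ht.lt hj1 hj

section Mesh

variable {α T : ℝ} {M : ℕ} {t : ℕ → ℝ}

theorem l1Weight_pos (hα1 : α < 1) (ht : IsTemporalMesh T M t) {m j : ℕ} (hj1 : 1 ≤ j)
    (hjm : j ≤ m) (hm : m ≤ M) : 0 < l1Weight α t m j := by
  have h1 : t (j - 1) < t j := ht.lt (by omega) (by omega)
  have h2 : t j ≤ t m := ht.le hjm hm
  unfold l1Weight
  refine div_pos (div_pos (sub_pos.2 ?_) (sub_pos.2 h1)) (by linarith)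
  exact Real.rpow_lt_rpow (by linarith) (by linarith) (by linarith)

/-- The weights increase towards the current node, because `y ↦ y ^ (1 - α)` is concave. -/
theorem l1Weight_le_succ (hα0 : 0 < α) (hα1 : α < 1) (ht : IsTemporalMesh T M t) {m j : ℕ}
    (hj1 : 1 ≤ j) (hjm : j + 1 ≤ m) (hm : m ≤ M) :
    l1Weight α t m j ≤ l1Weight α t m (j + 1) := by
  have h1 : t (j - 1) < t j := ht.lt (by omega) (by omega)
  have h2 : t j < t (j + 1) := ht.lt (by omega) (by omega)
  have h3 : t (j + 1) ≤ t m := ht.le hjm hm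
  have h := (Real.concaveOn_rpow (p := 1 - α) (by linarith) (by linarith)).slope_anti_adjacent
    (x := t m - t (j + 1)) (y := t m - t j) (z := t m - t (j - 1))
    (by simp only [Set.mem_Ici]; linarith) (by simp only [Set.mem_Ici]; linarith)
    (by linarith) (by linarith)
  unfold l1Weight
  rw [Nat.add_sub_cancel]
  refine div_le_div_of_nonneg_right ?_ (by linarith)
  convert h using 2 <;> ring

/-- Summation by parts: the weighted increments of a grid function that is nonnegative before the
node `m` are bounded by its value at `m`. -/
theorem sum_weight_le (hα0 : 0 < α) (hα1 : α < 1) (ht : IsTemporalMesh T M t) {m : ℕ}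
    (hm : m ≤ M) {W : ℕ → ℝ} (hW : ∀ i < m, 0 ≤ W i) {p : ℕ} (hp : 1 ≤ p) (hpm : p ≤ m) :
    ∑ j ∈ Finset.Icc 1 p, (W j - W (j - 1)) * l1Weight α t m j ≤ W p * l1Weight α t m p := by
  induction p, hp using Nat.le_induction with
  | base =>
    have h1 := (l1Weight_pos hα1 ht le_rfl hpm hm).le
    have h2 := hW 0 (by omega)
    simp only [Finset.Icc_self, Finset.sum_singleton, Nat.sub_self]
    nlinarith
  | succ k hk ih =>
    rw [Finset.sum_Icc_succ_top (by omega), Nat.add_sub_cancel]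
    have h1 := ih (by omega)
    have h2 := l1Weight_le_succ hα0 hα1 ht hk hpm hm
    have h3 := hW k (by omega)
    nlinarith [mul_le_mul_of_nonneg_left h2 h3]

theorem nonneg_of_l1Caputo_nonneg (hα0 : 0 < α) (hα1 : α < 1) (ht : IsTemporalMesh T M t)
    {W : ℕ → ℝ} (hW0 : 0 ≤ W 0) {m : ℕ} (hm : m ≤ M)
    (hW : ∀ j, 1 ≤ j → j ≤ m → 0 ≤ l1Caputo α t W j) : 0 ≤ W m := by
  induction m using Nat.strong_induction_on with
  | _ m ih =>
    rcases Nat.eq_zero_or_pos m with rfl | hm1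
    · exact hW0
    have hprev : ∀ i < m, 0 ≤ W i := fun i hi =>
      ih i hi (by omega) fun j hj1 hj => hW j hj1 (by omega)
    have h1 := sum_weight_le hα0 hα1 ht hm hprev hm1 le_rfl
    have h2 := hW m hm1 le_rfl
    rw [l1Caputo_eq_sum_weight hα1] at h2
    have h3 : 0 < 1 / Real.Gamma (1 - α) := one_div_pos.2 (Real.Gamma_pos_of_pos (by linarith))
    have h4 := nonneg_of_mul_nonneg_right h2 h3
    exact nonneg_of_mul_nonneg_left (h4.trans h1) (l1Weight_pos hα1 ht hm1 le_rfl hm)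

theorem le_of_l1Caputo_le (hα0 : 0 < α) (hα1 : α < 1) (ht : IsTemporalMesh T M t)
    {V B : ℕ → ℝ} (h0 : V 0 ≤ B 0) {m : ℕ} (hm : m ≤ M)
    (h : ∀ j, 1 ≤ j → j ≤ m → l1Caputo α t V j ≤ l1Caputo α t B j) : V m ≤ B m := by
  refine sub_nonneg.1 (nonneg_of_l1Caputo_nonneg hα0 hα1 ht (W := fun j => B j - V j)
    (sub_nonneg.2 h0) hm fun j hj1 hj => ?_)
  rw [l1Caputo_sub hα1]
  exact sub_nonneg.2 (h j hj1 hj)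

/-- Stability follows from barriers. The barrier may depend on the node `m` at which `V` is to be
bounded, since only its values up to that node matter. -/
theorem stability_of_barrier (hα0 : 0 < α) (hα1 : α < 1) (ht : IsTemporalMesh T M t) {γ C : ℝ}
    (h : ∀ m, 1 ≤ m → m ≤ M → ∃ B : ℕ → ℝ, 0 ≤ B 0 ∧
      (∀ j, 1 ≤ j → j ≤ m → (t 1 / t j) ^ (γ + 1) ≤ l1Caputo α t B j) ∧
      B m ≤ C * stabilityMajorant α γ (t 1) (t m)) :
    StabilityProperty α γ C M t ∧ StabilityPropertyAbs α γ C M t := by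
  have key : ∀ (V : ℕ → ℝ) (K : ℝ), 0 ≤ K → V 0 = 0 → ∀ m, 1 ≤ m → m ≤ M →
      (∀ j, 1 ≤ j → j ≤ m → l1Caputo α t V j ≤ K * (t 1 / t j) ^ (γ + 1)) →
      V m ≤ C * K * stabilityMajorant α γ (t 1) (t m) := by
    intro V K hK hV0 m hm1 hm hV
    obtain ⟨B, hB0, hB, hBm⟩ := h m hm1 hm
    have h1 : V m ≤ K * B m := by
      refine le_of_l1Caputo_le hα0 hα1 ht (B := fun j => K * B j) ?_ hm fun j hj1 hj => ?_
      · rw [hV0]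
        exact mul_nonneg hK hB0
      · rw [l1Caputo_const_mul hα1]
        exact (hV j hj1 hj).trans (mul_le_mul_of_nonneg_left (hB j hj1 hj) hK)
    calc V m ≤ K * B m := h1
      _ ≤ K * (C * stabilityMajorant α γ (t 1) (t m)) := mul_le_mul_of_nonneg_left hBm hK
      _ = C * K * stabilityMajorant α γ (t 1) (t m) := by ring
  refine ⟨fun V K hK hV0 hV m hm1 hm => abs_le'.2 ⟨?_, ?_⟩, fun V K hK hV0 hV m hm1 hm => ?_⟩
  · exact key V K hK hV0 m hm1 hm fun j hj1 hj => (abs_le'.1 (hV j hj1 (by omega))).1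
  · refine key (fun j => -V j) K hK (by simp [hV0]) m hm1 hm fun j hj1 hj => ?_
    rw [l1Caputo_neg hα1]
    exact (abs_le'.1 (hV j hj1 (by omega))).2
  · exact key (fun j => |V j|) K hK (by simp [hV0]) m hm1 hm fun j hj1 hj =>
      hV j hj1 (by omega)

/-! ### Arbitrary meshes -/

theorem rpow_neg_le_l1Weight (hα0 : 0 < α) (hα1 : α < 1) (ht : IsTemporalMesh T M t) {m j : ℕ}
    (hj1 : 1 ≤ j) (hjm : j ≤ m) (hm : m ≤ M) : t m ^ (-α) ≤ l1Weight α t m j := by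
  induction j, hj1 using Nat.le_induction with
  | base =>
    have h1 : 0 < t 1 := ht.pos le_rfl (by omega)
    have h2 : t 1 ≤ t m := ht.le hjm hm
    have h3 : 0 < t m := h1.trans_le h2
    have h4 := rpow_one_add_le_one_add_mul_self (s := -(t 1 / t m))
      (by rw [neg_le_neg_iff]; exact div_le_one_of_le₀ h2 h3.le) (p := 1 - α) (by linarith)
      (by linarith)
    have h5 : (t m - t 1) ^ (1 - α) = t m ^ (1 - α) * (1 + -(t 1 / t m)) ^ (1 - α) := by
      rw [← Real.mul_rpow h3.le]
      · congr 1
        field_simp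
        ring
      · have := div_le_one_of_le₀ h2 h3.le
        linarith
    have h6 : t m ^ (1 - α) = t m * t m ^ (-α) := by
      rw [sub_eq_add_neg, Real.rpow_add h3, Real.rpow_one]
    unfold l1Weight
    rw [Nat.sub_self, ht.zero, sub_zero, sub_zero, div_div, le_div_iff₀ (by nlinarith), h5]
    have h7 : 0 ≤ t m ^ (1 - α) := Real.rpow_nonneg h3.le _
    have h8 : t m ^ (-α) * (t 1 * (1 - α)) = t m ^ (1 - α) * ((1 - α) * (t 1 / t m)) := by
      rw [h6]
      field_simp
    rw [h8]
    nlinarith [mul_le_mul_of_nonneg_left h4 h7]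
  | succ k hk ih =>
    exact (ih (by omega)).trans (l1Weight_le_succ hα0 hα1 ht hk hjm hm)

theorem rpow_neg_mul_le_l1Caputo (hα0 : 0 < α) (hα1 : α < 1) (ht : IsTemporalMesh T M t)
    {B : ℕ → ℝ} (hB0 : B 0 = 0) {m : ℕ} (hB : ∀ j, 1 ≤ j → j ≤ m → B (j - 1) ≤ B j)
    (hm : m ≤ M) : 1 / Real.Gamma (1 - α) * (t m ^ (-α) * B m) ≤ l1Caputo α t B m := by
  rw [l1Caputo_eq_sum_weight hα1]
  have h3 : 0 < 1 / Real.Gamma (1 - α) := one_div_pos.2 (Real.Gamma_pos_of_pos (by linarith))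
  refine mul_le_mul_of_nonneg_left ?_ h3.le
  have htel : ∀ p : ℕ, ∑ j ∈ Finset.Icc 1 p, (B j - B (j - 1)) = B p := by
    intro p
    induction p with
    | zero => simp [hB0]
    | succ k ih => rw [Finset.sum_Icc_succ_top (by omega), ih, Nat.add_sub_cancel]; ring
  rw [← htel m, Finset.mul_sum]
  refine Finset.sum_le_sum fun j hj => ?_
  rw [Finset.mem_Icc] at hj
  rw [mul_comm]
  exact mul_le_mul_of_nonneg_left (rpow_neg_le_l1Weight hα0 hα1 ht hj.1 hj.2 hm)
    (sub_nonneg.2 (hB j hj.1 hj.2))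

/-- For `γ ≤ α - 1` the increasing barrier `t ^ (α - 1 - γ)` works on every mesh. -/
theorem stability_of_le (hα0 : 0 < α) (hα1 : α < 1) (ht : IsTemporalMesh T M t) {γ : ℝ}
    (hγ : γ ≤ α - 1) : StabilityProperty α γ (Real.Gamma (1 - α)) M t ∧
      StabilityPropertyAbs α γ (Real.Gamma (1 - α)) M t := by
  refine stability_of_barrier hα0 hα1 ht fun m hm1 hm => ?_
  have hG : 0 < Real.Gamma (1 - α) := Real.Gamma_pos_of_pos (by linarith)
  have hτ : 0 < t 1 := ht.pos le_rfl (by omega)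
  -- The value at the node `0` is set separately, as `0 ^ 0 = 1` in the case `γ = α - 1`.
  let P : ℕ → ℝ := fun j => if j = 0 then 0 else t 1 ^ (γ + 1) * t j ^ (α - 1 - γ)
  have hP : ∀ j, 1 ≤ j → P j = t 1 ^ (γ + 1) * t j ^ (α - 1 - γ) := fun j hj => by
    simp only [P, if_neg (by omega : ¬ j = 0)]
  refine ⟨fun j => Real.Gamma (1 - α) * P j, by simp [P], fun j hj1 hj => ?_, ?_⟩
  · have htj : 0 < t j := ht.pos hj1 (by omega)
    have h1 := rpow_neg_mul_le_l1Caputo hα0 hα1 ht (B := P) (by simp [P]) (m := j)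
      (fun i hi1 hi => ?_) (by omega)
    · rw [l1Caputo_const_mul hα1]
      refine le_trans (le_of_eq ?_) (mul_le_mul_of_nonneg_left h1 hG.le)
      rw [hP j hj1, Real.div_rpow hτ.le htj.le, div_eq_mul_inv, ← Real.rpow_neg htj.le]
      rw [show -(γ + 1) = -α + (α - 1 - γ) by ring, Real.rpow_add htj]
      field_simp
    · rcases Nat.eq_or_lt_of_le hi1 with rfl | hi2
      · rw [hP 1 le_rfl]
        simp only [P, Nat.sub_self, if_true]
        positivity
      · rw [hP i hi1, hP (i - 1) (by omega)]
        refine mul_le_mul_of_nonneg_left ?_ (Real.rpow_nonneg hτ.le _)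
        exact Real.rpow_le_rpow (ht.pos (by omega) (by omega)).le
          (ht.le (by omega) (by omega)) (by linarith)
  · have htm : 0 < t m := ht.pos hm1 hm
    refine le_of_eq ?_
    simp only
    congr 1
    rw [hP m hm1]
    unfold stabilityMajorant
    rw [if_neg (by linarith), if_neg (by linarith), Real.div_rpow hτ.le htm.le,
      Real.rpow_add hτ, Real.rpow_one, Real.rpow_sub htm (α - 1) γ]
    ring

end Mesh

/-! ### Tangent-line inequalities for powers -/

theorem rpow_tangent_le {q y z : ℝ} (hq : q ≤ 0) (hy : 0 < y) (hz : 0 < z) :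
    y ^ q + q * y ^ (q - 1) * (z - y) ≤ z ^ q := by
  have hw : 0 < z / y := div_pos hz hy
  have h1 : z ^ q = y ^ q * (z / y) ^ q := by
    rw [← Real.mul_rpow hy.le hw.le, mul_div_cancel₀ _ hy.ne']
  have h2 : q * (z / y - 1) + 1 ≤ (z / y) ^ q := by
    rw [Real.rpow_def_of_pos hw]
    have h3 := Real.log_le_sub_one_of_pos hw
    have h4 := Real.add_one_le_exp (Real.log (z / y) * q)
    nlinarith
  have h5 : y ^ q + q * y ^ (q - 1) * (z - y) = y ^ q * (q * (z / y - 1) + 1) := by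
    rw [Real.rpow_sub_one hy.ne']
    field_simp
    ring
  rw [h1, h5]
  exact mul_le_mul_of_nonneg_left h2 (Real.rpow_nonneg hy.le _)

theorem rpow_le_tangent {p y z : ℝ} (hp0 : 0 ≤ p) (hp1 : p ≤ 1) (hy : 0 < y) (hz : 0 ≤ z) :
    z ^ p ≤ y ^ p + p * y ^ (p - 1) * (z - y) := by
  have hw : 0 ≤ z / y := div_nonneg hz hy.le
  have h1 : z ^ p = y ^ p * (1 + (z / y - 1)) ^ p := by
    rw [add_sub_cancel, ← Real.mul_rpow hy.le hw, mul_div_cancel₀ _ hy.ne']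
  have h2 := rpow_one_add_le_one_add_mul_self (s := z / y - 1) (by linarith) hp0 hp1
  have h5 : y ^ p + p * y ^ (p - 1) * (z - y) = y ^ p * (1 + p * (z / y - 1)) := by
    rw [Real.rpow_sub_one hy.ne']
    field_simp
  rw [h1, h5]
  exact mul_le_mul_of_nonneg_left h2 (Real.rpow_nonneg hy.le _)

theorem rpow_le_eight_mul_rpow {e y u : ℝ} (he3 : -3 ≤ e) (he0 : e ≤ 0) (hy : 0 < y)
    (hu : y / 2 ≤ u) : u ^ e ≤ 8 * y ^ e := by
  have h1 : u ^ e ≤ (y / 2) ^ e := Real.rpow_le_rpow_of_nonpos (by linarith) hu he0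
  have h2 : (y / 2) ^ e = (2 : ℝ) ^ (-e) * y ^ e := by
    rw [Real.div_rpow hy.le (by norm_num), Real.rpow_neg (by norm_num)]
    field_simp
  have h3 : (2 : ℝ) ^ (-e) ≤ (2 : ℝ) ^ (3 : ℝ) :=
    Real.rpow_le_rpow_of_exponent_le (by norm_num) (by linarith)
  have h4 : (2 : ℝ) ^ (3 : ℝ) = 8 := by norm_num
  rw [h4] at h3
  rw [h2] at h1
  exact h1.trans (mul_le_mul_of_nonneg_right h3 (Real.rpow_nonneg hy.le _))

/-! ### The kernel on one mesh interval -/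

/-- An antiderivative in `s` of the kernel `(x - s) ^ (-α)`. -/
noncomputable def kernelPrim (α x s : ℝ) : ℝ := -((x - s) ^ (1 - α) / (1 - α))

/-- The integral of `(x - s) ^ (-α) - (x - u) ^ (-α)` over `(u, v)`. It measures the variation of
the kernel on a mesh interval. -/
noncomputable def kernelExcess (α x u v : ℝ) : ℝ :=
  kernelPrim α x v - kernelPrim α x u - (x - u) ^ (-α) * (v - u)

/-- An antiderivative in `s` of `(x - s) ^ (-α) - (x + H - s) ^ (-α)`. -/
noncomputable def kernelGapPrim (α x H s : ℝ) : ℝ :=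
  ((x + H - s) ^ (1 - α) - (x - s) ^ (1 - α)) / (1 - α)

section Kernel

variable {α x u v : ℝ}

theorem kernelPrim_continuous (hα1 : α < 1) : Continuous (kernelPrim α x) := by
  unfold kernelPrim
  refine Continuous.neg (Continuous.div_const ?_ _)
  exact (continuous_const.sub continuous_id).rpow_const fun _ => Or.inr (by linarith)

theorem kernelPrim_hasDerivAt (hα1 : α < 1) {s : ℝ} (hs : s < x) :
    HasDerivAt (kernelPrim α x) ((x - s) ^ (-α)) s := by
  have h1 : HasDerivAt (fun s => x - s) (-1) s := by
    simpa using (hasDerivAt_id s).const_sub x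
  have h2 := ((h1.rpow_const (p := 1 - α) (Or.inl (by linarith))).div_const (1 - α)).neg
  refine h2.congr_deriv ?_
  rw [show 1 - α - 1 = -α by ring]
  field_simp [show 1 - α ≠ 0 by linarith]

theorem kernelExcess_nonneg (hα0 : 0 < α) (hα1 : α < 1) (huv : u < v) (hvx : v ≤ x) :
    0 ≤ kernelExcess α x u v := by
  have h := rpow_le_tangent (p := 1 - α) (y := x - u) (z := x - v) (by linarith) (by linarith)
    (by linarith) (by linarith)
  rw [show 1 - α - 1 = -α by ring] at h
  have hp : 0 < 1 - α := by linarith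
  unfold kernelExcess kernelPrim
  have h2 : -((x - v) ^ (1 - α) / (1 - α)) - -((x - u) ^ (1 - α) / (1 - α)) =
      ((x - u) ^ (1 - α) - (x - v) ^ (1 - α)) / (1 - α) := by ring
  rw [h2, sub_nonneg, le_div_iff₀ hp]
  linarith

theorem kernelExcess_le_of_lt (hα0 : 0 < α) (hα1 : α < 1) (huv : u < v) (hvx : v < x) :
    kernelExcess α x u v ≤ (v - u) ^ 2 * (x - v) ^ (-α - 1) := by
  have h := rpow_le_tangent (p := 1 - α) (y := x - v) (z := x - u) (by linarith) (by linarith)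
    (by linarith) (by linarith)
  have h' := rpow_tangent_le (q := -α) (y := x - v) (z := x - u) (by linarith)
    (by linarith) (by linarith)
  rw [show 1 - α - 1 = -α by ring] at h
  have hp : 0 < 1 - α := by linarith
  have hX : 0 ≤ (x - v) ^ (-α - 1) := Real.rpow_nonneg (by linarith) _
  unfold kernelExcess kernelPrim
  have h2 : -((x - v) ^ (1 - α) / (1 - α)) - -((x - u) ^ (1 - α) / (1 - α)) =
      ((x - u) ^ (1 - α) - (x - v) ^ (1 - α)) / (1 - α) := by ring
  rw [h2, sub_le_iff_le_add, div_le_iff₀ hp]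
  have h3 := mul_le_mul_of_nonneg_right h' (sub_nonneg.2 huv.le)
  have h4 : α * ((x - v) ^ (-α - 1) * (v - u) ^ 2) ≤ (x - v) ^ (-α - 1) * (v - u) ^ 2 := by
    nlinarith [mul_nonneg hX (sq_nonneg (v - u))]
  have h5 : (x - v) ^ (-α) * (v - u) ≤ (v - u) ^ 2 * (x - v) ^ (-α - 1) +
      (x - u) ^ (-α) * (v - u) := by nlinarith
  nlinarith [mul_le_mul_of_nonneg_right h5 hp.le]

theorem kernelExcess_le_rpow (hα0 : 0 < α) (hα1 : α < 1) (huv : u < v) (hvx : v ≤ x) :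
    kernelExcess α x u v ≤ (v - u) ^ (1 - α) / (1 - α) := by
  have hp : 0 < 1 - α := by linarith
  have h := Real.rpow_add_le_add_rpow (p := 1 - α) (a := x - v) (b := v - u) (by linarith)
    (by linarith) hp.le (by linarith)
  rw [show x - v + (v - u) = x - u by ring] at h
  have h3 : 0 ≤ (x - u) ^ (-α) * (v - u) :=
    mul_nonneg (Real.rpow_nonneg (by linarith) _) (by linarith)
  have h4 := div_le_div_of_nonneg_right h hp.le
  rw [add_div] at h4
  unfold kernelExcess kernelPrim
  linarith

theorem kernelExcess_le_gap (hα0 : 0 < α) (hα1 : α < 1) (huv : u < v) (hvx : v ≤ x) {H : ℝ}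
    (hH : v - u ≤ H) :
    kernelExcess α x u v ≤ kernelGapPrim α x H v - kernelGapPrim α x H u := by
  have hp : 0 < 1 - α := by linarith
  have h := rpow_le_tangent (p := 1 - α) (y := x + H - v) (z := x + H - u) hp.le (by linarith)
    (by linarith) (by linarith)
  rw [show 1 - α - 1 = -α by ring, show x + H - u - (x + H - v) = v - u by ring] at h
  have h1 : (x + H - v) ^ (-α) ≤ (x - u) ^ (-α) :=
    Real.rpow_le_rpow_of_nonpos (by linarith) (by linarith) (by linarith)
  have h2 : ((x + H - u) ^ (1 - α) - (x + H - v) ^ (1 - α)) / (1 - α) ≤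
      (x - u) ^ (-α) * (v - u) := by
    rw [div_le_iff₀ hp]
    nlinarith [mul_le_mul_of_nonneg_right (mul_le_mul_of_nonneg_right h1
      (sub_nonneg.2 huv.le)) hp.le]
  unfold kernelExcess kernelPrim kernelGapPrim
  rw [sub_div] at h2
  rw [sub_div, sub_div]
  linarith

/-- Replacing `φ` by a constant `q` in `∫ (x - s) ^ (-α) φ(s) ds` over `(a, b)`, in terms of
antiderivatives `f` of `φ` and `F` of `(x - s) ^ (-α) φ(s)`: subtracting the constant
`(x - u) ^ (-α)` from the kernel leaves a nonnegative factor, so a one-sided bound on `φ - q`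
suffices. -/
theorem kernel_average_le (hα0 : 0 < α) (hα1 : α < 1) {a b q ω : ℝ} (hua : u ≤ a) (hab : a ≤ b)
    (hbx : b ≤ x) {f F φ : ℝ → ℝ}
    (hf : ContinuousOn f (Set.Icc a b)) (hF : ContinuousOn F (Set.Icc a b))
    (hf' : ∀ s ∈ Set.Ioo a b, HasDerivAt f (φ s) s)
    (hF' : ∀ s ∈ Set.Ioo a b, HasDerivAt F ((x - s) ^ (-α) * φ s) s)
    (hω : ∀ s ∈ Set.Ioo a b, φ s ≤ q + ω) :
    (F b - F a) - (x - u) ^ (-α) * (f b - f a) ≤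
      (q + ω) * (kernelPrim α x b - kernelPrim α x a - (x - u) ^ (-α) * (b - a)) := by
  set κ := (x - u) ^ (-α) with hκ
  have hder : ∀ s ∈ Set.Ioo a b, HasDerivAt
      (fun s => (q + ω) * (kernelPrim α x s - κ * s) - (F s - κ * f s))
      ((q + ω) * ((x - s) ^ (-α) - κ * 1) - ((x - s) ^ (-α) * φ s - κ * φ s)) s := fun s hs =>
    (((kernelPrim_hasDerivAt hα1 (hs.2.trans_le hbx)).sub
      ((hasDerivAt_id s).const_mul κ)).const_mul (q + ω)).sub
      ((hF' s hs).sub ((hf' s hs).const_mul κ))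
  have hmono : MonotoneOn (fun s => (q + ω) * (kernelPrim α x s - κ * s) - (F s - κ * f s))
      (Set.Icc a b) := by
    refine monotoneOn_of_deriv_nonneg (convex_Icc a b) ?_ ?_ ?_
    · exact (continuousOn_const.mul ((kernelPrim_continuous hα1).continuousOn.sub
        (continuousOn_const.mul continuousOn_id))).sub (hF.sub (continuousOn_const.mul hf))
    · rw [interior_Icc]
      exact fun s hs => (hder s hs).differentiableAt.differentiableWithinAt
    · rw [interior_Icc]
      intro s hs
      rw [(hder s hs).deriv]
      have h1 : κ ≤ (x - s) ^ (-α) :=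
        Real.rpow_le_rpow_of_nonpos (by linarith [hs.2]) (by linarith [hs.1]) (by linarith)
      nlinarith [mul_nonneg (sub_nonneg.2 h1) (sub_nonneg.2 (hω s hs))]
  have h := hmono (Set.left_mem_Icc.2 hab) (Set.right_mem_Icc.2 hab) hab
  simp only at h
  linarith

end Kernel

/-! ### The barrier profile and its truncation error -/

/-- The barrier profile: linear on `[0, 1]` and equal to the singular solution `s ^ (α - 1)` of the
homogeneous fractional equation from `1` on. -/
noncomputable def profile (α s : ℝ) : ℝ := if s ≤ 1 then s else s ^ (α - 1)

/-- An antiderivative in `s` of `(x - s) ^ (-α) * (α - 1) * s ^ (α - 2)`, the kernel times the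
derivative of `s ^ (α - 1)`. -/
noncomputable def tailPrim (α x s : ℝ) : ℝ := (x - s) ^ (1 - α) * s ^ (α - 1) / x

/-- The integral over `(0, s)` of the kernel `(x - ·) ^ (-α)` times the derivative of the barrier
profile. -/
noncomputable def profilePrim (α x s : ℝ) : ℝ :=
  if s ≤ 1 then kernelPrim α x s - kernelPrim α x 0
  else kernelPrim α x 1 - kernelPrim α x 0 + (tailPrim α x s - tailPrim α x 1)

/-- The growth exponent of the steps of a graded mesh with the largest admissible grading
exponent `r = (2 - α) / α`, that is `σ = 1 - 1 / r`. -/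
noncomputable def gradingExp (α : ℝ) : ℝ := (2 - 2 * α) / (2 - α)

/-- The decay exponent `η > 0` of the accumulated truncation error, `2 σ + α - 3 = -1 - η`. -/
noncomputable def errorExp (α : ℝ) : ℝ := α ^ 2 / (2 - α)

/-- A bound for the truncation error accumulated on `(0, s)`, on meshes with steps at most
`ε s ^ σ`: the jump at `1` stems from the kink of the profile, the term with `1 - s ^ (-η)` from
the intervals in `(1, x / 2)`, and the last term from those near `x`. -/
noncomputable def errorPrim (α ε x s : ℝ) : ℝ :=
  if s ≤ 1 then 0
  else x ^ (-α - 1) * ((32 * ((2 * ε) ^ (1 - α) / (1 - α)) + 64 * ε ^ 2) +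
      128 * ε ^ 2 / errorExp α * (1 - s ^ (-errorExp α))) +
    128 * ε * x ^ (gradingExp α + α - 3) *
      (kernelGapPrim α x (ε * x ^ gradingExp α) s - kernelGapPrim α x (ε * x ^ gradingExp α) 1)

section Profile

variable {α : ℝ}

theorem gradingExp_nonneg (hα1 : α < 1) : 0 ≤ gradingExp α :=
  div_nonneg (by linarith) (by linarith)

theorem gradingExp_le_one (hα0 : 0 < α) (hα1 : α < 1) : gradingExp α ≤ 1 :=
  (div_le_one (by linarith)).2 (by linarith)

theorem gradingExp_mul (hα1 : α < 1) : gradingExp α * (2 - α) = 2 - 2 * α :=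
  div_mul_cancel₀ _ (by linarith)

theorem errorExp_pos (hα0 : 0 < α) (hα1 : α < 1) : 0 < errorExp α :=
  div_pos (by positivity) (by linarith)

theorem two_mul_gradingExp_add (hα1 : α < 1) :
    2 * gradingExp α + α - 3 = -errorExp α - 1 := by
  unfold gradingExp errorExp
  field_simp [show 2 - α ≠ 0 by linarith]
  ring

theorem tailPrim_continuousOn (hα1 : α < 1) (x : ℝ) : ContinuousOn (tailPrim α x) (Set.Ioi 0) := by
  unfold tailPrim
  refine ContinuousOn.div_const (ContinuousOn.mul ?_ ?_) _
  · exact ((continuous_const.sub continuous_id).rpow_const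
      fun _ => Or.inr (by linarith)).continuousOn
  · exact continuousOn_id.rpow_const fun s hs => Or.inl (ne_of_gt hs)

theorem hasDerivAt_rpow_sub_one {s : ℝ} (hs : 0 < s) :
    HasDerivAt (fun s : ℝ => s ^ (α - 1)) ((α - 1) * s ^ (α - 2)) s := by
  have h := Real.hasDerivAt_rpow_const (x := s) (p := α - 1) (Or.inl hs.ne')
  rwa [show α - 1 - 1 = α - 2 by ring] at h

theorem tailPrim_hasDerivAt {s x : ℝ} (hs : 0 < s) (hsx : s < x) :
    HasDerivAt (tailPrim α x) ((x - s) ^ (-α) * ((α - 1) * s ^ (α - 2))) s := by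
  have h1 : HasDerivAt (fun s => x - s) (-1) s := by
    simpa using (hasDerivAt_id s).const_sub x
  have hxs : 0 < x - s := by linarith
  have h2 := ((h1.rpow_const (p := 1 - α) (Or.inl hxs.ne')).mul
    (hasDerivAt_rpow_sub_one (α := α) hs)).div_const x
  refine h2.congr_deriv ?_
  have e1 : (x - s) ^ (1 - α) = (x - s) * (x - s) ^ (-α) := by
    rw [sub_eq_add_neg 1 α, Real.rpow_add hxs, Real.rpow_one]
  have e2 : s ^ (α - 1) = s * s ^ (α - 2) := by
    rw [show α - 1 = 1 + (α - 2) by ring, Real.rpow_add hs, Real.rpow_one]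
  rw [show 1 - α - 1 = -α by ring, e1, e2]
  field_simp [show x ≠ 0 by linarith]
  ring

/-- The operator applied to the profile itself, rather than to its interpolant, is positive. -/
theorem le_profilePrim_self (hα0 : 0 < α) (hα1 : α < 1) {x : ℝ} (hx : 1 < x) :
    (1 - α) * x ^ (-α - 1) ≤ profilePrim α x x := by
  have hx0 : 0 < x := by linarith
  have hp : 0 < 1 - α := by linarith
  have h := rpow_le_tangent (p := 1 - α) (y := x) (z := x - 1) hp.le (by linarith) hx0
    (by linarith)
  have e1 : x ^ (1 - α) = x ^ (-α - 1) * x ^ 2 := by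
    rw [show 1 - α = (-α - 1) + (2 : ℕ) by push_cast; ring, Real.rpow_add_natCast hx0.ne']
  have e2 : x ^ (1 - α - 1) = x ^ (-α - 1) * x := by
    rw [show 1 - α - 1 = (-α - 1) + 1 by ring, Real.rpow_add_one hx0.ne']
  rw [e1, e2] at h
  have hz : (0 : ℝ) ^ (1 - α) = 0 := Real.zero_rpow hp.ne'
  unfold profilePrim kernelPrim tailPrim
  rw [if_neg (by linarith), sub_self, hz, sub_zero, Real.one_rpow, e1]
  have h1 : (x ^ (-α - 1) * x ^ 2 - (x - 1) ^ (1 - α)) / (1 - α) ≥ x ^ (-α - 1) * x := by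
    rw [ge_iff_le, le_div_iff₀ hp]
    linarith
  have h2 : (x - 1) ^ (1 - α) / x ≤ x ^ (-α - 1) * (x - (1 - α)) := by
    rw [div_le_iff₀ hx0]
    linarith
  have h3 : -((x - 1) ^ (1 - α) / (1 - α)) - -(x ^ (-α - 1) * x ^ 2 / (1 - α)) +
      (0 * x ^ (α - 1) / x - (x - 1) ^ (1 - α) * 1 / x) =
      (x ^ (-α - 1) * x ^ 2 - (x - 1) ^ (1 - α)) / (1 - α) - (x - 1) ^ (1 - α) / x := by ring
  rw [h3]
  linarith

theorem profile_eq_of_one_le {s : ℝ} (hs : 1 ≤ s) : profile α s = s ^ (α - 1) := by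
  unfold profile
  split_ifs with h
  · rw [le_antisymm h hs, Real.one_rpow]
  · rfl

theorem profilePrim_eq_of_one_le {x s : ℝ} (hs : 1 ≤ s) : profilePrim α x s =
    kernelPrim α x 1 - kernelPrim α x 0 + (tailPrim α x s - tailPrim α x 1) := by
  unfold profilePrim
  split_ifs with h
  · rw [le_antisymm h hs]
    ring
  · rfl

theorem kernelGapPrim_one_le (hα0 : 0 < α) (hα1 : α < 1) {x v H : ℝ} (hv : 1 < v) (hvx : v ≤ x)
    (hH : v - 1 ≤ H) : kernelGapPrim α x H 1 ≤ kernelGapPrim α x H v := by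
  linarith [kernelExcess_nonneg hα0 hα1 hv hvx, kernelExcess_le_gap hα0 hα1 hv hvx hH]

section Interval

variable {ε x u v : ℝ}

/-- The truncation error on an interval to the right of the kink, before summation. -/
theorem tailPrim_sub_le (hα0 : 0 < α) (hα1 : α < 1) (hu : 1 ≤ u) (huv : u < v) (hvx : v ≤ x)
    (hvu : v / 2 ≤ u) :
    tailPrim α x v - tailPrim α x u ≤
      (profile α v - profile α u) / (v - u) * (kernelPrim α x v - kernelPrim α x u) +
        16 * (v - u) * v ^ (α - 3) * kernelExcess α x u v := by
  have hu0 : 0 < u := by linarith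
  have hv0 : 0 < v := by linarith
  have hh : 0 < v - u := by linarith
  rw [profile_eq_of_one_le hu, profile_eq_of_one_le (hu.trans huv.le)]
  set q := (v ^ (α - 1) - u ^ (α - 1)) / (v - u) with hq
  have hqh : q * (v - u) = v ^ (α - 1) - u ^ (α - 1) := div_mul_cancel₀ _ hh.ne'
  have hq1 : (α - 1) * u ^ (α - 2) ≤ q := by
    rw [hq, le_div_iff₀ hh]
    have h := rpow_tangent_le (q := α - 1) (by linarith) hu0 hv0
    rw [show α - 1 - 1 = α - 2 by ring] at h
    linarith
  have hosc : u ^ (α - 2) - v ^ (α - 2) ≤ 16 * (v - u) * v ^ (α - 3) := by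
    have h := rpow_tangent_le (q := α - 2) (by linarith) hu0 hv0
    rw [show α - 2 - 1 = α - 3 by ring] at h
    have h2 : u ^ (α - 3) ≤ 8 * v ^ (α - 3) :=
      rpow_le_eight_mul_rpow (by linarith) (by linarith) hv0 hvu
    have h3 : 0 ≤ u ^ (α - 3) := Real.rpow_nonneg hu0.le _
    have h4 : (2 - α) * (u ^ (α - 3) * (v - u)) ≤ 2 * (u ^ (α - 3) * (v - u)) :=
      mul_le_mul_of_nonneg_right (by linarith) (mul_nonneg h3 hh.le)
    nlinarith [mul_le_mul_of_nonneg_right h2 hh.le]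
  have h := kernel_average_le (x := x) (u := u) (a := u) (b := v) (q := q)
    (ω := 16 * (v - u) * v ^ (α - 3)) hα0 hα1 le_rfl huv.le hvx
    (f := fun s => s ^ (α - 1)) (F := tailPrim α x) (φ := fun s => (α - 1) * s ^ (α - 2))
    (continuousOn_id.rpow_const fun s hs => Or.inl (by simp only [id]; linarith [hs.1]))
    ((tailPrim_continuousOn hα1 x).mono fun s hs => hu0.trans_le hs.1)
    (fun s hs => hasDerivAt_rpow_sub_one (hu0.trans hs.1))
    (fun s hs => tailPrim_hasDerivAt (hu0.trans hs.1) (hs.2.trans_le hvx))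
    (fun s hs => by
      have h1 : v ^ (α - 2) ≤ s ^ (α - 2) :=
        Real.rpow_le_rpow_of_nonpos (hu0.trans hs.1) hs.2.le (by linarith)
      have h5 : v ^ (α - 2) ≤ u ^ (α - 2) :=
        Real.rpow_le_rpow_of_nonpos hu0 huv.le (by linarith)
      nlinarith)
  rw [← hqh] at h
  unfold kernelExcess
  linarith

/-- The truncation error on the interval containing the kink, before summation. -/
theorem profilePrim_sub_le_kink (hα0 : 0 < α) (hα1 : α < 1) (hu : u < 1)
    (hv : 1 < v) (hvx : v ≤ x) :
    profilePrim α x v - profilePrim α x u ≤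
      (profile α v - profile α u) / (v - u) * (kernelPrim α x v - kernelPrim α x u) +
        2 * kernelExcess α x u v := by
  have hv0 : 0 < v := by linarith
  have hh : 0 < v - u := by linarith
  have hpu : profile α u = u := if_pos hu.le
  have hPu : profilePrim α x u = kernelPrim α x u - kernelPrim α x 0 := if_pos hu.le
  rw [profile_eq_of_one_le hv.le, hpu, profilePrim_eq_of_one_le hv.le, hPu]
  set q := (v ^ (α - 1) - u) / (v - u) with hq
  have hqh : q * (v - u) = v ^ (α - 1) - u := div_mul_cancel₀ _ hh.ne'
  have hq1 : -1 ≤ q := by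
    rw [hq, le_div_iff₀ hh]
    have h := rpow_tangent_le (q := α - 1) (by linarith) one_pos hv0
    rw [Real.one_rpow, Real.one_rpow] at h
    nlinarith
  have h1 := kernel_average_le (x := x) (u := u) (a := u) (b := 1) (q := q)
    (ω := 2) hα0 hα1 le_rfl hu.le (hv.le.trans hvx)
    (f := fun s => s) (F := kernelPrim α x) (φ := fun _ => 1)
    continuousOn_id (kernelPrim_continuous hα1).continuousOn
    (fun s _ => hasDerivAt_id s)
    (fun s hs => by
      rw [mul_one]
      exact kernelPrim_hasDerivAt hα1 (by linarith [hs.2]))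
    (fun s _ => by linarith)
  have h2 := kernel_average_le (x := x) (u := u) (a := 1) (b := v) (q := q)
    (ω := 2) hα0 hα1 hu.le hv.le hvx
    (f := fun s => s ^ (α - 1)) (F := tailPrim α x) (φ := fun s => (α - 1) * s ^ (α - 2))
    (continuousOn_id.rpow_const fun s hs => Or.inl (by simp only [id]; linarith [hs.1]))
    ((tailPrim_continuousOn hα1 x).mono fun s hs => one_pos.trans_le hs.1)
    (fun s hs => hasDerivAt_rpow_sub_one (one_pos.trans hs.1))
    (fun s hs => tailPrim_hasDerivAt (one_pos.trans hs.1) (hs.2.trans_le hvx))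
    (fun s hs => by
      have h3 : 0 ≤ s ^ (α - 2) := Real.rpow_nonneg (by linarith [hs.1]) _
      nlinarith)
  simp only [Real.one_rpow] at h1 h2
  have h3 : (x - u) ^ (-α) * (q * (v - u)) = (x - u) ^ (-α) * (v ^ (α - 1) - u) := by rw [hqh]
  unfold kernelExcess
  linarith

/-- The step bound `h ≤ ε v ^ σ` with `ε ≤ 1 / 2` makes neighbouring nodes beyond `1`
comparable. -/
theorem half_le_of_step_le (hα0 : 0 < α) (hα1 : α < 1) (hε0 : 0 < ε) (hε : ε ≤ 1 / 2)
    (hv : 1 < v) (hstep : v - u ≤ ε * v ^ gradingExp α) : v / 2 ≤ u := by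
  have h1 : v ^ gradingExp α ≤ v := by
    simpa using Real.rpow_le_rpow_of_exponent_le hv.le (gradingExp_le_one hα0 hα1)
  nlinarith [mul_le_mul_of_nonneg_left h1 hε0.le]

theorem rpow_step_le_errorExp (hα0 : 0 < α) (hα1 : α < 1) (hu : 0 < u) (huv : u < v) :
    (v - u) * v ^ (-errorExp α - 1) ≤
      (u ^ (-errorExp α) - v ^ (-errorExp α)) / errorExp α := by
  have hη := errorExp_pos hα0 hα1
  have h := rpow_tangent_le (q := -errorExp α) (y := v) (z := u) (by linarith)
    (by linarith) hu
  rw [le_div_iff₀ hη]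
  linarith

/-- On the intervals in `(1, x / 2)` the kernel is smooth. -/
theorem excess_le_far (hα0 : 0 < α) (hα1 : α < 1) (hε0 : 0 < ε) (hu : 1 ≤ u) (huv : u < v)
    (hvx : v ≤ x / 2) (hstep : v - u ≤ ε * v ^ gradingExp α) :
    16 * (v - u) * v ^ (α - 3) * kernelExcess α x u v ≤
      x ^ (-α - 1) * (128 * ε ^ 2 / errorExp α * (u ^ (-errorExp α) - v ^ (-errorExp α))) := by
  have hv0 : 0 < v := by linarith
  have hh : 0 < v - u := by linarith
  have hX : 0 ≤ x ^ (-α - 1) := Real.rpow_nonneg (by linarith) _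
  have hV : 0 ≤ v ^ (α - 3) := Real.rpow_nonneg hv0.le _
  have h1 := kernelExcess_le_of_lt hα0 hα1 huv (x := x) (by linarith)
  have h2 : (x - v) ^ (-α - 1) ≤ 8 * x ^ (-α - 1) :=
    rpow_le_eight_mul_rpow (by linarith) (by linarith) (by linarith) (by linarith)
  have h3 : (v - u) ^ 2 ≤ ε ^ 2 * v ^ (2 * gradingExp α) := by
    calc (v - u) ^ 2 ≤ (ε * v ^ gradingExp α) ^ 2 := pow_le_pow_left₀ hh.le hstep 2
      _ = ε ^ 2 * v ^ (2 * gradingExp α) := by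
        rw [mul_pow, ← Real.rpow_mul_natCast hv0.le]
        congr 2
        push_cast
        ring
  have h4 : v ^ (2 * gradingExp α) * v ^ (α - 3) = v ^ (-errorExp α - 1) := by
    rw [← Real.rpow_add hv0, ← two_mul_gradingExp_add hα1]
    congr 1
    ring
  have h5 := rpow_step_le_errorExp hα0 hα1 (by linarith) huv
  calc 16 * (v - u) * v ^ (α - 3) * kernelExcess α x u v
      ≤ 16 * (v - u) * v ^ (α - 3) *
          ((ε ^ 2 * v ^ (2 * gradingExp α)) * (8 * x ^ (-α - 1))) := by
        refine mul_le_mul_of_nonneg_left (h1.trans ?_) (by positivity)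
        exact mul_le_mul h3 h2 (Real.rpow_nonneg (by linarith) _) (by positivity)
    _ = 128 * ε ^ 2 * x ^ (-α - 1) *
          ((v - u) * (v ^ (2 * gradingExp α) * v ^ (α - 3))) := by ring
    _ ≤ 128 * ε ^ 2 * x ^ (-α - 1) *
          ((u ^ (-errorExp α) - v ^ (-errorExp α)) / errorExp α) := by
        rw [h4]
        exact mul_le_mul_of_nonneg_left h5 (by positivity)
    _ = _ := by ring

/-- Near `x` the steps are at most `H = ε x ^ σ`, and the kernel at the left end point of an
interval exceeds the kernel shifted by `H`. -/
theorem excess_le_near (hα0 : 0 < α) (hα1 : α < 1) (hε0 : 0 < ε) (hu : 1 ≤ u) (huv : u < v)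
    (hvx : v ≤ x) (hv2 : x / 2 ≤ v) (hstep : v - u ≤ ε * v ^ gradingExp α) :
    16 * (v - u) * v ^ (α - 3) * kernelExcess α x u v ≤
      128 * ε * x ^ (gradingExp α + α - 3) *
        (kernelGapPrim α x (ε * x ^ gradingExp α) v -
          kernelGapPrim α x (ε * x ^ gradingExp α) u) := by
  have hv0 : 0 < v := by linarith
  have hσ0 := gradingExp_nonneg hα1
  have hσ1 := gradingExp_le_one hα0 hα1
  have hH : v - u ≤ ε * x ^ gradingExp α :=
    hstep.trans (mul_le_mul_of_nonneg_left (Real.rpow_le_rpow hv0.le hvx hσ0) hε0.le)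
  have h1 := kernelExcess_le_gap hα0 hα1 huv hvx hH
  have h2 : v ^ gradingExp α * v ^ (α - 3) ≤ 8 * x ^ (gradingExp α + α - 3) := by
    rw [← Real.rpow_add hv0, show gradingExp α + (α - 3) = gradingExp α + α - 3 by ring]
    exact rpow_le_eight_mul_rpow (by linarith) (by linarith) (by linarith) hv2
  have hV : 0 ≤ v ^ (α - 3) := Real.rpow_nonneg hv0.le _
  have h3 : 16 * (v - u) * v ^ (α - 3) ≤ 128 * ε * x ^ (gradingExp α + α - 3) := by
    nlinarith [mul_le_mul_of_nonneg_right hstep hV, mul_le_mul_of_nonneg_left h2 hε0.le]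
  refine (mul_le_mul_of_nonneg_right h3 (kernelExcess_nonneg hα0 hα1 huv hvx)).trans ?_
  refine mul_le_mul_of_nonneg_left h1 (mul_nonneg (by linarith) (Real.rpow_nonneg ?_ _))
  linarith

theorem excess_le_kink (hα0 : 0 < α) (hα1 : α < 1) (hε0 : 0 < ε) (hε : ε ≤ 1 / 2)
    (hu : u < 1) (hv : 1 < v) (hvx : v ≤ x) (hstep : v - u ≤ ε * v ^ gradingExp α) :
    2 * kernelExcess α x u v ≤
      x ^ (-α - 1) * (32 * ((2 * ε) ^ (1 - α) / (1 - α)) + 64 * ε ^ 2) := by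
  have hp : 0 < 1 - α := by linarith
  have hvu := half_le_of_step_le hα0 hα1 hε0 hε hv hstep
  have h1 : v ^ gradingExp α ≤ v := by
    simpa using Real.rpow_le_rpow_of_exponent_le hv.le (gradingExp_le_one hα0 hα1)
  have hh : v - u ≤ 2 * ε := by nlinarith [mul_le_mul_of_nonneg_left h1 hε0.le]
  have hh0 : 0 < v - u := by linarith
  have hX : 0 ≤ x ^ (-α - 1) := Real.rpow_nonneg (by linarith) _
  have hE : 0 ≤ (2 * ε) ^ (1 - α) / (1 - α) := div_nonneg (Real.rpow_nonneg (by linarith) _) hp.le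
  rcases le_total x 4 with hx4 | hx4
  · have h2 := kernelExcess_le_rpow hα0 hα1 (hu.trans hv) hvx
    have h3 : (v - u) ^ (1 - α) / (1 - α) ≤ (2 * ε) ^ (1 - α) / (1 - α) :=
      div_le_div_of_nonneg_right (Real.rpow_le_rpow hh0.le hh hp.le) hp.le
    have h4 : 1 ≤ 16 * x ^ (-α - 1) := by
      have h5 : (4 : ℝ) ^ (-α - 1) ≤ x ^ (-α - 1) :=
        Real.rpow_le_rpow_of_nonpos (by linarith) hx4 (by linarith)
      have h6 : (4 : ℝ) ^ (-2 : ℝ) ≤ (4 : ℝ) ^ (-α - 1) :=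
        Real.rpow_le_rpow_of_exponent_le (by norm_num) (by linarith)
      have h7 : (4 : ℝ) ^ (-2 : ℝ) = 1 / 16 := by
        rw [Real.rpow_neg (by norm_num)]
        norm_num
      rw [h7] at h6
      linarith
    nlinarith [mul_le_mul_of_nonneg_right h4 hE, mul_nonneg hX (sq_nonneg ε)]
  · have h2 := kernelExcess_le_of_lt hα0 hα1 (hu.trans hv) (x := x) (by linarith)
    have h3 : (x - v) ^ (-α - 1) ≤ 8 * x ^ (-α - 1) :=
      rpow_le_eight_mul_rpow (by linarith) (by linarith) (by linarith) (by linarith)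
    have h4 : (v - u) ^ 2 ≤ (2 * ε) ^ 2 := pow_le_pow_left₀ hh0.le hh 2
    have h5 : (v - u) ^ 2 * (x - v) ^ (-α - 1) ≤ (2 * ε) ^ 2 * (8 * x ^ (-α - 1)) :=
      mul_le_mul h4 h3 (Real.rpow_nonneg (by linarith) _) (by positivity)
    nlinarith [mul_nonneg hX hE]

/-- The contribution of one mesh interval to the L1 operator of the profile, bounded below by
differences, which telescope under summation. -/
theorem interval_contribution_ge (hα0 : 0 < α) (hα1 : α < 1) (hε0 : 0 < ε) (hε : ε ≤ 1 / 2)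
    (hx : 1 < x) (huv : u < v) (hvx : v ≤ x)
    (hstep : 1 < v → v - u ≤ ε * v ^ gradingExp α) :
    (profilePrim α x v - errorPrim α ε x v) - (profilePrim α x u - errorPrim α ε x u) ≤
      (profile α v - profile α u) / (v - u) * (kernelPrim α x v - kernelPrim α x u) := by
  have hp : 0 < 1 - α := by linarith
  have hη := errorExp_pos hα0 hα1
  have hX : 0 ≤ x ^ (-α - 1) := Real.rpow_nonneg (by linarith) _
  rcases le_or_gt v 1 with hv | hv
  · have hu : u ≤ 1 := huv.le.trans hv
    unfold profilePrim errorPrim profile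
    rw [if_pos hv, if_pos hv, if_pos hv, if_pos hu, if_pos hu, if_pos hu,
      div_self (by linarith)]
    linarith
  have hstep := hstep hv
  have hvH : ε * v ^ gradingExp α ≤ ε * x ^ gradingExp α :=
    mul_le_mul_of_nonneg_left (Real.rpow_le_rpow (by linarith) hvx (gradingExp_nonneg hα1)) hε0.le
  set c1 := 128 * ε ^ 2 / errorExp α with hc1
  set c2 := 128 * ε * x ^ (gradingExp α + α - 3) with hc2
  set c3 := 32 * ((2 * ε) ^ (1 - α) / (1 - α)) + 64 * ε ^ 2 with hc3
  set H := ε * x ^ gradingExp α with hHdef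
  have hc1' : 0 ≤ c1 := by positivity
  have hc2' : 0 ≤ c2 := mul_nonneg (by linarith) (Real.rpow_nonneg (by linarith) _)
  have hc3' : 0 ≤ c3 := by
    have := Real.rpow_nonneg (show 0 ≤ 2 * ε by linarith) (1 - α)
    positivity
  have hEv : errorPrim α ε x v = x ^ (-α - 1) * (c3 + c1 * (1 - v ^ (-errorExp α))) +
      c2 * (kernelGapPrim α x H v - kernelGapPrim α x H 1) := if_neg (by linarith)
  rcases lt_or_ge u 1 with hu | hu
  · have h1 := profilePrim_sub_le_kink hα0 hα1 hu hv hvx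
    have h2 := excess_le_kink hα0 hα1 hε0 hε hu hv hvx hstep
    have hEu : errorPrim α ε x u = 0 := if_pos hu.le
    have h3 := kernelGapPrim_one_le hα0 hα1 hv hvx (H := H) (by linarith)
    have h4 : v ^ (-errorExp α) ≤ 1 := Real.rpow_le_one_of_one_le_of_nonpos hv.le (by linarith)
    rw [hEv, hEu]
    have h5 := mul_nonneg hX (mul_nonneg hc1' (sub_nonneg.2 h4))
    have h6 := mul_nonneg hc2' (sub_nonneg.2 h3)
    linarith
  · have hvu := half_le_of_step_le hα0 hα1 hε0 hε hv hstep
    have h1 := tailPrim_sub_le hα0 hα1 hu huv hvx hvu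
    -- At `u = 1` the jump of the error bound has not yet been counted.
    have hEu : errorPrim α ε x u ≤ x ^ (-α - 1) * (c3 + c1 * (1 - u ^ (-errorExp α))) +
        c2 * (kernelGapPrim α x H u - kernelGapPrim α x H 1) := by
      rcases hu.eq_or_lt with rfl | hu
      · have h2 : errorPrim α ε x 1 = 0 := if_pos le_rfl
        rw [h2, Real.one_rpow, sub_self, sub_self, mul_zero, mul_zero, add_zero, add_zero]
        exact mul_nonneg hX hc3'
      · exact le_of_eq (if_neg (by linarith))
    rw [hEv, profilePrim_eq_of_one_le hv.le, profilePrim_eq_of_one_le hu]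
    have hgap : 0 ≤ kernelGapPrim α x H v - kernelGapPrim α x H u :=
      (kernelExcess_nonneg hα0 hα1 huv hvx).trans
        (kernelExcess_le_gap hα0 hα1 huv hvx (by linarith))
    have hpow : v ^ (-errorExp α) ≤ u ^ (-errorExp α) :=
      Real.rpow_le_rpow_of_nonpos (by linarith) huv.le (by linarith)
    have h5 := mul_nonneg hX (mul_nonneg hc1' (sub_nonneg.2 hpow))
    have h6 := mul_nonneg hc2' hgap
    rcases le_total v (x / 2) with hv2 | hv2
    · have h2 := excess_le_far hα0 hα1 hε0 hu huv hv2 hstep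
      rw [← hc1] at h2
      linarith
    · have h2 := excess_le_near hα0 hα1 hε0 hu huv hvx hv2 hstep
      rw [← hc2, ← hHdef] at h2
      linarith

theorem errorPrim_self_le (hα0 : 0 < α) (hα1 : α < 1) (hε0 : 0 < ε) (hε : ε ≤ 1 / 2)
    (hx : 1 < x) :
    errorPrim α ε x x ≤
      (256 / (1 - α) + 64 + 128 / errorExp α) * ε ^ (1 - α) * x ^ (-α - 1) := by
  have hx0 : 0 < x := by linarith
  have hp : 0 < 1 - α := by linarith
  have hη := errorExp_pos hα0 hα1
  have hX : 0 ≤ x ^ (-α - 1) := Real.rpow_nonneg hx0.le _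
  have hE : 0 ≤ ε ^ (1 - α) := Real.rpow_nonneg hε0.le _
  have hEε : ε ≤ ε ^ (1 - α) := by
    simpa using Real.rpow_le_rpow_of_exponent_ge hε0 (by linarith) (show 1 - α ≤ 1 by linarith)
  have h2 : (2 * ε) ^ (1 - α) ≤ 2 * ε ^ (1 - α) := by
    rw [Real.mul_rpow (by norm_num) hε0.le]
    refine mul_le_mul_of_nonneg_right ?_ hE
    simpa using Real.rpow_le_rpow_of_exponent_le (show (1 : ℝ) ≤ 2 by norm_num)
      (show 1 - α ≤ 1 by linarith)
  have hε2 : ε ^ 2 ≤ ε ^ (1 - α) := by nlinarith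
  have hgap : kernelGapPrim α x (ε * x ^ gradingExp α) x -
      kernelGapPrim α x (ε * x ^ gradingExp α) 1 ≤
        ε ^ (1 - α) * x ^ (gradingExp α * (1 - α)) / (1 - α) := by
    have hHn : 0 ≤ ε * x ^ gradingExp α := mul_nonneg hε0.le (Real.rpow_nonneg hx0.le _)
    have h1 : 0 ≤ kernelGapPrim α x (ε * x ^ gradingExp α) 1 :=
      div_nonneg (sub_nonneg.2 (Real.rpow_le_rpow (by linarith) (by linarith) hp.le)) hp.le
    refine (sub_le_self _ h1).trans (le_of_eq ?_)
    unfold kernelGapPrim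
    rw [sub_self, Real.zero_rpow hp.ne', sub_zero, add_sub_cancel_left,
      Real.mul_rpow hε0.le (Real.rpow_nonneg hx0.le _), ← Real.rpow_mul hx0.le]
  have hprod : x ^ (gradingExp α + α - 3) * x ^ (gradingExp α * (1 - α)) = x ^ (-α - 1) := by
    rw [← Real.rpow_add hx0]
    congr 1
    linarith [gradingExp_mul hα1]
  have hlast : 128 * ε * x ^ (gradingExp α + α - 3) *
      (kernelGapPrim α x (ε * x ^ gradingExp α) x -
        kernelGapPrim α x (ε * x ^ gradingExp α) 1) ≤
      128 / (1 - α) * ε ^ (1 - α) * x ^ (-α - 1) := by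
    have hA : 0 ≤ x ^ (gradingExp α + α - 3) := Real.rpow_nonneg hx0.le _
    calc _ ≤ 128 * ε * x ^ (gradingExp α + α - 3) *
          (ε ^ (1 - α) * x ^ (gradingExp α * (1 - α)) / (1 - α)) :=
          mul_le_mul_of_nonneg_left hgap (by positivity)
      _ = ε * (128 / (1 - α) * ε ^ (1 - α) *
          (x ^ (gradingExp α + α - 3) * x ^ (gradingExp α * (1 - α)))) := by ring
      _ ≤ 1 * (128 / (1 - α) * ε ^ (1 - α) *
          (x ^ (gradingExp α + α - 3) * x ^ (gradingExp α * (1 - α)))) := by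
          refine mul_le_mul_of_nonneg_right (by linarith) ?_
          rw [hprod]
          positivity
      _ = _ := by rw [hprod, one_mul]
  have hfar : 128 * ε ^ 2 / errorExp α * (1 - x ^ (-errorExp α)) ≤
      128 / errorExp α * ε ^ (1 - α) := by
    have h1 : 0 ≤ x ^ (-errorExp α) := Real.rpow_nonneg hx0.le _
    calc 128 * ε ^ 2 / errorExp α * (1 - x ^ (-errorExp α))
        ≤ 128 * ε ^ 2 / errorExp α * 1 :=
          mul_le_mul_of_nonneg_left (by linarith) (by positivity)
      _ = 128 / errorExp α * ε ^ 2 := by ring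
      _ ≤ _ := mul_le_mul_of_nonneg_left hε2 (by positivity)
  have hkink : 32 * ((2 * ε) ^ (1 - α) / (1 - α)) + 64 * ε ^ 2 ≤
      (128 / (1 - α) + 64) * ε ^ (1 - α) := by
    have h1 := div_le_div_of_nonneg_right h2 hp.le
    have h3 : 128 / (1 - α) * ε ^ (1 - α) = 64 * (2 * ε ^ (1 - α) / (1 - α)) := by ring
    have h4 : 0 ≤ 2 * ε ^ (1 - α) / (1 - α) := by positivity
    linarith
  unfold errorPrim
  rw [if_neg (by linarith)]
  have h6 := mul_le_mul_of_nonneg_left (add_le_add hkink hfar) hX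
  have h7 : 256 / (1 - α) = 128 / (1 - α) + 128 / (1 - α) := by ring
  rw [h7]
  linarith

end Interval

/-- A smallness threshold for the mesh, at which the truncation error is at most half of the lower
bound of `le_profilePrim_self`. -/
theorem exists_small_step (hα0 : 0 < α) (hα1 : α < 1) : ∃ ε : ℝ, 0 < ε ∧ ε ≤ 1 / 2 ∧
    (256 / (1 - α) + 64 + 128 / errorExp α) * ε ^ (1 - α) ≤ (1 - α) / 2 := by
  have hp : 0 < 1 - α := by linarith
  have hη := errorExp_pos hα0 hα1
  set c := 256 / (1 - α) + 64 + 128 / errorExp α with hc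
  have hc0 : 0 < c := by positivity
  have hd : 0 < (1 - α) / (2 * c) := by positivity
  refine ⟨min (1 / 2) (((1 - α) / (2 * c)) ^ (1 / (1 - α))),
    lt_min (by norm_num) (Real.rpow_pos_of_pos hd _), min_le_left _ _, ?_⟩
  have h1 : (min (1 / 2) (((1 - α) / (2 * c)) ^ (1 / (1 - α)))) ^ (1 - α) ≤
      (1 - α) / (2 * c) := by
    refine (Real.rpow_le_rpow (le_min (by norm_num) (Real.rpow_nonneg hd.le _))
      (min_le_right _ _) hp.le).trans (le_of_eq ?_)
    rw [← Real.rpow_mul hd.le, one_div_mul_cancel hp.ne', Real.rpow_one]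
  refine (mul_le_mul_of_nonneg_left h1 hc0.le).trans (le_of_eq ?_)
  field_simp

/-- The L1 operator of the profile is positive on meshes that are fine enough, with the decay
`x ^ (-α - 1)` beyond the kink. -/
theorem exists_l1Caputo_profile_ge (hα0 : 0 < α) (hα1 : α < 1) : ∃ ε : ℝ, 0 < ε ∧
    ∀ (y : ℕ → ℝ) (m : ℕ), 1 ≤ m → y 0 = 0 → (∀ j, 1 ≤ j → j ≤ m → y (j - 1) < y j) →
      (∀ j, 1 ≤ j → j ≤ m → 1 < y j → y j - y (j - 1) ≤ ε * y j ^ gradingExp α) →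
      (y m ≤ 1 → y m ^ (1 - α) ≤
        Real.Gamma (1 - α) * l1Caputo α y (fun j => profile α (y j)) m) ∧
      (1 < y m → (1 - α) / 2 * y m ^ (-α - 1) ≤
        Real.Gamma (1 - α) * l1Caputo α y (fun j => profile α (y j)) m) := by
  obtain ⟨ε, hε0, hε, hsmall⟩ := exists_small_step hα0 hα1
  refine ⟨ε, hε0, fun y m hm hy0 hlt hstep => ?_⟩
  have hp : 0 < 1 - α := by linarith
  have hG : 0 < Real.Gamma (1 - α) := Real.Gamma_pos_of_pos hp
  have hmono : ∀ k, ∀ j ≤ k, k ≤ m → y j ≤ y k := by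
    intro k
    induction k with
    | zero => intro j hj _; rw [Nat.le_zero.1 hj]
    | succ k ih =>
      intro j hj hk
      rcases Nat.eq_or_lt_of_le hj with rfl | hj
      · exact le_rfl
      · exact (ih j (by omega) (by omega)).trans (hlt (k + 1) (by omega) hk).le
  have hsum : Real.Gamma (1 - α) * l1Caputo α y (fun j => profile α (y j)) m =
      ∑ j ∈ Finset.Icc 1 m, (profile α (y j) - profile α (y (j - 1))) / (y j - y (j - 1)) *
        (kernelPrim α (y m) (y j) - kernelPrim α (y m) (y (j - 1))) := by
    rw [l1Caputo_eq_sum_weight hα1, ← mul_assoc, mul_one_div_cancel hG.ne', one_mul]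
    refine Finset.sum_congr rfl fun j _ => ?_
    unfold l1Weight kernelPrim
    ring
  have htel : ∀ (f : ℝ → ℝ) (k : ℕ),
      ∑ j ∈ Finset.Icc 1 k, (f (y j) - f (y (j - 1))) = f (y k) - f 0 := by
    intro f k
    induction k with
    | zero => simp [hy0]
    | succ k ih => rw [Finset.sum_Icc_succ_top (by omega), ih, Nat.add_sub_cancel]; ring
  rw [hsum]
  have hym : 0 < y m := by
    have := hlt 1 le_rfl hm
    rw [Nat.sub_self, hy0] at this
    exact this.trans_le (hmono m 1 hm le_rfl)
  refine ⟨fun hle => ?_, fun hgt => ?_⟩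
  · have h1 : ∀ j ∈ Finset.Icc 1 m,
        (profile α (y j) - profile α (y (j - 1))) / (y j - y (j - 1)) *
        (kernelPrim α (y m) (y j) - kernelPrim α (y m) (y (j - 1))) =
        kernelPrim α (y m) (y j) - kernelPrim α (y m) (y (j - 1)) := by
      intro j hj
      rw [Finset.mem_Icc] at hj
      have h2 := hlt j hj.1 hj.2
      have h3 := hmono m j hj.2 le_rfl
      unfold profile
      rw [if_pos (by linarith), if_pos (by linarith), div_self (by linarith), one_mul]
    rw [Finset.sum_congr rfl h1, htel (kernelPrim α (y m))]
    unfold kernelPrim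
    rw [sub_self, Real.zero_rpow hp.ne', sub_zero, zero_div, neg_zero, zero_sub, neg_neg,
      le_div_iff₀ hp]
    nlinarith [Real.rpow_nonneg hym.le (1 - α)]
  · have h1 := Finset.sum_le_sum fun j (hj : j ∈ Finset.Icc 1 m) =>
      have hj := Finset.mem_Icc.1 hj
      interval_contribution_ge (x := y m) (u := y (j - 1)) (v := y j) hα0 hα1 hε0 hε hgt
        (hlt j hj.1 hj.2)
        (hmono m j hj.2 le_rfl) (hstep j hj.1 hj.2)
    refine le_trans ?_ h1
    rw [htel (fun s => profilePrim α (y m) s - errorPrim α ε (y m) s)]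
    have h2 := le_profilePrim_self hα0 hα1 hgt
    have h3 := errorPrim_self_le hα0 hα1 hε0 hε hgt
    have h4 : profilePrim α (y m) 0 = 0 := by
      unfold profilePrim
      rw [if_pos zero_le_one, sub_self]
    have h5 : errorPrim α ε (y m) 0 = 0 := if_pos zero_le_one
    have h6 := mul_le_mul_of_nonneg_right hsmall (Real.rpow_nonneg hym.le (-α - 1))
    simp only [h4, h5]
    linarith

end Profile

/-! ### Superposition over dyadic scales -/

/-- Among the dyadic scales up to `x`, the finest one dominates if `γ > 0` and the coarsest one if
`γ < 0`, while all of them contribute equally if `γ = 0`. -/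
theorem exists_dyadic_sum_le (γ : ℝ) : ∃ C : ℝ, 0 < C ∧ ∀ (x : ℝ) (n : ℕ), 1 ≤ x → 2 ^ n ≤ x →
    ∑ k ∈ Finset.range (n + 1), ((2 : ℝ) ^ k) ^ (-γ) ≤
      C * (if 0 < γ then 1 else if γ = 0 then 1 + Real.log x else (1 / x) ^ γ) := by
  have hpow : ∀ k : ℕ, ((2 : ℝ) ^ k) ^ (-γ) = ((2 : ℝ) ^ (-γ)) ^ k := fun k => by
    rw [← Real.rpow_natCast_mul (by norm_num), ← Real.rpow_mul_natCast (by norm_num), mul_comm]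
  have hq0 : 0 < (2 : ℝ) ^ (-γ) := Real.rpow_pos_of_pos (by norm_num) _
  rcases lt_trichotomy 0 γ with hγ | hγ | hγ
  · have hq1 : (2 : ℝ) ^ (-γ) < 1 := Real.rpow_lt_one_of_one_lt_of_neg (by norm_num) (by linarith)
    refine ⟨(1 - (2 : ℝ) ^ (-γ))⁻¹, inv_pos.2 (by linarith), fun x n _ _ => ?_⟩
    rw [if_pos hγ, mul_one, ← tsum_geometric_of_lt_one hq0.le hq1]
    simp only [hpow]
    exact (summable_geometric_of_lt_one hq0.le hq1).sum_le_tsum _ fun k _ => by positivity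
  · subst hγ
    refine ⟨2, by norm_num, fun x n hx hn => ?_⟩
    have h1 : (n : ℝ) * Real.log 2 ≤ Real.log x := by
      rw [← Real.log_pow]
      exact Real.log_le_log (by positivity) hn
    have h2 := Real.log_two_gt_d9
    have h3 : (0 : ℝ) ≤ n := Nat.cast_nonneg n
    simp only [lt_irrefl, if_false, if_true, neg_zero, Real.rpow_zero, Finset.sum_const,
      Finset.card_range, nsmul_eq_mul, mul_one]
    push_cast
    nlinarith
  · have hq1 : 1 < (2 : ℝ) ^ (-γ) := Real.one_lt_rpow (by norm_num) (by linarith)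
    refine ⟨(2 : ℝ) ^ (-γ) / ((2 : ℝ) ^ (-γ) - 1), div_pos hq0 (by linarith), fun x n hx hn => ?_⟩
    rw [if_neg (by linarith), if_neg (by linarith)]
    simp only [hpow]
    rw [geom_sum_eq hq1.ne', div_mul_eq_mul_div]
    refine div_le_div_of_nonneg_right ?_ (by linarith)
    have h1 : ((2 : ℝ) ^ (-γ)) ^ n ≤ (1 / x) ^ γ := by
      rw [← hpow, one_div, Real.inv_rpow (by linarith), ← Real.rpow_neg (by linarith)]
      exact Real.rpow_le_rpow (by positivity) hn (by linarith)
    rw [pow_succ]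
    nlinarith [mul_le_mul_of_nonneg_left h1 hq0.le]

theorem profile_le_rpow {α s : ℝ} (hα1 : α < 1) (hs : 0 < s) : profile α s ≤ s ^ (α - 1) := by
  unfold profile
  split_ifs with h
  · exact h.trans (Real.one_le_rpow_of_pos_of_le_one_of_nonpos hs h (by linarith))
  · exact le_rfl

theorem rpow_le_rpow_abs {b y : ℝ} (q : ℝ) (hy : 1 ≤ y) (hyb : y ≤ b) : y ^ q ≤ b ^ |q| :=
  (Real.rpow_le_rpow_of_exponent_le hy (le_abs_self q)).trans
    (Real.rpow_le_rpow (by linarith) hyb (abs_nonneg q))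

section Graded

variable {α T r c : ℝ} {M : ℕ} {t : ℕ → ℝ}

theorem one_sub_inv_le_gradingExp (hα0 : 0 < α) (hα1 : α < 1) (hr1 : 1 ≤ r)
    (hr2 : r ≤ (2 - α) / α) : 1 - 1 / r ≤ gradingExp α := by
  have h1 : (2 - α) * (1 / r) ≥ α := by
    rw [le_div_iff₀ hα0] at hr2
    rw [mul_one_div, ge_iff_le, le_div_iff₀ (by linarith)]
    linarith
  unfold gradingExp
  rw [le_div_iff₀ (by linarith)]
  linarith

/-- In units of `a = t 1 * N` with `N` large, the mesh is as fine as the analysis of the profile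
requires. -/
theorem scaled_step_le (hα0 : 0 < α) (hα1 : α < 1) (hr1 : 1 ≤ r) (hr2 : r ≤ (2 - α) / α)
    (hc : 0 < c) {ε N : ℝ} (hN0 : 0 < N) (hN : c ≤ ε * N ^ (1 / r))
    {τ u v : ℝ} (hτ : 0 < τ) (hstep : v - u ≤ c * (τ ^ (1 / r) * v ^ (1 - 1 / r)))
    (hv : 1 < v / (τ * N)) :
    v / (τ * N) - u / (τ * N) ≤ ε * (v / (τ * N)) ^ gradingExp α := by
  have ha : 0 < τ * N := by positivity
  have hy : 0 < v / (τ * N) := by linarith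
  have hNr : 0 < N ^ (1 / r) := Real.rpow_pos_of_pos hN0 _
  have hτr : 0 < τ ^ (1 / r) := Real.rpow_pos_of_pos hτ _
  have hε : 0 < ε := pos_of_mul_pos_left (hc.trans_le hN) hNr.le
  set y := v / (τ * N) with hydef
  have hvy : v = τ * N * y := by
    rw [hydef]
    field_simp
  have h1 : v ^ (1 - 1 / r) = τ * N / (τ ^ (1 / r) * N ^ (1 / r)) * y ^ (1 - 1 / r) := by
    rw [hvy, Real.mul_rpow ha.le hy.le, Real.rpow_sub ha, Real.rpow_one,
      Real.mul_rpow hτ.le hN0.le]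
  have h2 : y ^ (1 - 1 / r) ≤ y ^ gradingExp α :=
    Real.rpow_le_rpow_of_exponent_le hv.le (one_sub_inv_le_gradingExp hα0 hα1 hr1 hr2)
  have h3 : y - u / (τ * N) = (v - u) / (τ * N) := by
    rw [hydef, sub_div]
  rw [h3, div_le_iff₀ ha]
  calc v - u ≤ c * (τ ^ (1 / r) * v ^ (1 - 1 / r)) := hstep
    _ = c / N ^ (1 / r) * (τ * N) * y ^ (1 - 1 / r) := by
      rw [h1]
      field_simp
    _ ≤ ε * (τ * N) * y ^ gradingExp α := by
      refine mul_le_mul (mul_le_mul_of_nonneg_right ?_ ha.le) h2 (Real.rpow_nonneg hy.le _)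
        (by positivity)
      rwa [div_le_iff₀ hNr]
    _ = ε * y ^ gradingExp α * (τ * N) := by ring

/-- Stability on meshes subject to the upper bound on the steps. The barrier is a superposition of
profiles with kinks at the dyadic scales `t 1 * N₀ * 2 ^ k`: the one whose kink is comparable to
`t j` makes the L1 operator large enough at the node `j`, and the others do no harm. -/
theorem exists_stability_of_step_le (hα0 : 0 < α) (hα1 : α < 1) (γ : ℝ) (hr1 : 1 ≤ r)
    (hr2 : r ≤ (2 - α) / α) (hc : 0 < c) : ∃ C : ℝ, 0 < C ∧ ∀ (T : ℝ) (M : ℕ) (t : ℕ → ℝ),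
      IsTemporalMesh T M t →
      (∀ j, 1 ≤ j → j ≤ M → t j - t (j - 1) ≤ c * (t 1 ^ (1 / r) * t j ^ (1 - 1 / r))) →
      StabilityProperty α γ C M t ∧ StabilityPropertyAbs α γ C M t := by
  obtain ⟨ε, hε0, hε⟩ := exists_l1Caputo_profile_ge hα0 hα1
  obtain ⟨D, hD0, hD⟩ := exists_dyadic_sum_le γ
  have hp : 0 < 1 - α := by linarith
  have hG : 0 < Real.Gamma (1 - α) := Real.Gamma_pos_of_pos hp
  have hr0 : 0 < r := by linarith
  obtain ⟨N₀, hN₀1, hN₀⟩ : ∃ N₀ : ℝ, 1 ≤ N₀ ∧ c ≤ ε * N₀ ^ (1 / r) := by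
    have hcε : 0 < c / ε := div_pos hc hε0
    refine ⟨max 1 ((c / ε) ^ r), le_max_left _ _, ?_⟩
    rw [← div_le_iff₀' hε0]
    have h1 : ((c / ε) ^ r) ^ (1 / r) ≤ (max 1 ((c / ε) ^ r)) ^ (1 / r) :=
      Real.rpow_le_rpow (Real.rpow_nonneg hcε.le _) (le_max_right _ _) (by positivity)
    rwa [← Real.rpow_mul hcε.le, mul_one_div_cancel hr0.ne', Real.rpow_one] at h1
  have hN₀0 : 0 < N₀ := by linarith
  -- The first summand serves the nodes below `t 1 * N₀`, the second one all others.
  obtain ⟨A, hA1, hA2⟩ : ∃ A : ℝ, N₀ ^ (γ + 2 + |γ + 1|) ≤ A ∧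
      8 * 2 ^ |γ + 1| / (1 - α) ≤ A :=
    ⟨_, le_add_of_nonneg_right (by positivity), le_add_of_nonneg_left (by positivity)⟩
  have hA0 : 0 < A := (Real.rpow_pos_of_pos hN₀0 _).trans_le hA1
  refine ⟨Real.Gamma (1 - α) * A * (N₀ ^ (-γ) * D), by positivity, fun T M t ht hstep =>
    stability_of_barrier hα0 hα1 ht fun m hm1 hm => ?_⟩
  have hτ : 0 < t 1 := ht.pos le_rfl (by omega)
  set τ := t 1 with hτdef
  have hx1 : ∀ j, 1 ≤ j → j ≤ M → 1 ≤ t j / τ := fun j hj1 hj =>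
    (one_le_div hτ).2 (ht.le hj1 hj)
  obtain ⟨n, hn1, hn2⟩ := exists_nat_pow_near (hx1 m hm1 hm) (one_lt_two)
  have hNk : ∀ k : ℕ, N₀ ≤ N₀ * 2 ^ k := fun k =>
    le_mul_of_one_le_right hN₀0.le (one_le_pow₀ (by norm_num))
  have hNk0 : ∀ k : ℕ, 0 < N₀ * 2 ^ k := fun k => by positivity
  -- The profile with kink at `t 1 * N`.
  let U : ℝ → ℕ → ℝ := fun N j => profile α (t j / (τ * N))
  have hU : ∀ N, N₀ ≤ N → ∀ j, 1 ≤ j → j ≤ M →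
      (t j / τ / N ≤ 1 → (t j / τ / N) ^ (1 - α) ≤
        Real.Gamma (1 - α) * ((τ * N) ^ α * l1Caputo α t (U N) j)) ∧
      (1 < t j / τ / N → (1 - α) / 2 * (t j / τ / N) ^ (-α - 1) ≤
        Real.Gamma (1 - α) * ((τ * N) ^ α * l1Caputo α t (U N) j)) := by
    intro N hN j hj1 hj
    have hN0 : 0 < N := by linarith
    have ha : 0 < τ * N := by positivity
    rw [div_div, ← l1Caputo_scale hα1 ha (fun i hi => ht.le hi hj)]
    refine hε (fun i => t i / (τ * N)) j hj1 (by simp [ht.zero]) (fun i hi1 hi => ?_)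
      (fun i hi1 hi hgt => ?_)
    · exact div_lt_div_of_pos_right (ht.lt (by omega) (by omega)) ha
    · refine scaled_step_le hα0 hα1 hr1 hr2 hc hN0 (hN₀.trans ?_) hτ
        (hstep i hi1 (by omega)) hgt
      exact mul_le_mul_of_nonneg_left (Real.rpow_le_rpow hN₀0.le hN (by positivity)) hε0.le
  have hU0 : ∀ N, N₀ ≤ N → ∀ j, 1 ≤ j → j ≤ M →
      0 ≤ Real.Gamma (1 - α) * ((τ * N) ^ α * l1Caputo α t (U N) j) := by
    intro N hN j hj1 hj
    have hy : 0 ≤ t j / τ / N :=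
      div_nonneg (zero_le_one.trans (hx1 j hj1 hj)) (by linarith)
    rcases le_or_gt (t j / τ / N) 1 with h | h
    · exact (Real.rpow_nonneg hy _).trans ((hU N hN j hj1 hj).1 h)
    · exact (mul_nonneg (by linarith) (Real.rpow_nonneg hy _)).trans ((hU N hN j hj1 hj).2 h)
  let N : ℕ → ℝ := fun k => N₀ * 2 ^ k
  refine ⟨fun j => Real.Gamma (1 - α) * A * ∑ k ∈ Finset.range (n + 1),
    N k ^ (-γ - 1) * (τ * N k) ^ α * U (N k) j, ?_, fun j hj1 hj => ?_, ?_⟩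
  · refine mul_nonneg (by positivity) (Finset.sum_nonneg fun k _ => ?_)
    have h1 : U (N k) 0 = 0 := by simp [U, profile, ht.zero]
    rw [h1, mul_zero]
  · have hjM : j ≤ M := hj.trans hm
    have htj : 0 < t j := ht.pos hj1 hjM
    have hx := hx1 j hj1 hjM
    have hsum : l1Caputo α t (fun j => Real.Gamma (1 - α) * A * ∑ k ∈ Finset.range (n + 1),
        N k ^ (-γ - 1) * (τ * N k) ^ α * U (N k) j) j = A * ∑ k ∈ Finset.range (n + 1),
        N k ^ (-γ - 1) * (Real.Gamma (1 - α) * ((τ * N k) ^ α * l1Caputo α t (U (N k)) j)) := by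
      rw [l1Caputo_const_mul hα1, l1Caputo_sum hα1, mul_comm (Real.Gamma (1 - α)) A, mul_assoc,
        Finset.mul_sum]
      congr 1
      refine Finset.sum_congr rfl fun k _ => ?_
      rw [l1Caputo_const_mul hα1]
      ring
    have hsingle : ∀ k ∈ Finset.range (n + 1), A * (N k ^ (-γ - 1) *
        (Real.Gamma (1 - α) * ((τ * N k) ^ α * l1Caputo α t (U (N k)) j))) ≤
        A * ∑ k ∈ Finset.range (n + 1), N k ^ (-γ - 1) *
          (Real.Gamma (1 - α) * ((τ * N k) ^ α * l1Caputo α t (U (N k)) j)) := by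
      intro k hk
      refine mul_le_mul_of_nonneg_left (Finset.single_le_sum (f := fun k => N k ^ (-γ - 1) *
          (Real.Gamma (1 - α) * ((τ * N k) ^ α * l1Caputo α t (U (N k)) j)))
          (fun i _ => ?_) hk) hA0.le
      exact mul_nonneg (Real.rpow_nonneg (hNk0 i).le _) (hU0 _ (hNk i) j hj1 hjM)
    rw [hsum]
    have hlhs : (τ / t j) ^ (γ + 1) = (t j / τ) ^ (-γ - 1) := by
      rw [← inv_div (t j) τ, Real.inv_rpow (by positivity), ← Real.rpow_neg (by positivity)]
      congr 1
      ring
    rw [hlhs]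
    have habs : |(-γ - 1)| = |γ + 1| := by
      rw [← abs_neg]
      congr 1
      ring
    rcases le_or_gt (t j / τ) N₀ with hle | hgt
    · refine le_trans ?_ (hsingle 0 (by simp))
      have hN0 : N 0 = N₀ := by simp [N]
      rw [hN0]
      have h1 := (hU N₀ le_rfl j hj1 hjM).1 ((div_le_one hN₀0).2 hle)
      have h2 : N₀ ^ (-1 : ℝ) ≤ (t j / τ / N₀) ^ (1 - α) := by
        calc N₀ ^ (-1 : ℝ) ≤ N₀ ^ (-(1 - α)) :=
              Real.rpow_le_rpow_of_exponent_le hN₀1 (by linarith)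
          _ = (1 / N₀) ^ (1 - α) := by
              rw [one_div, Real.inv_rpow hN₀0.le, Real.rpow_neg hN₀0.le]
          _ ≤ _ := Real.rpow_le_rpow (by positivity)
              (div_le_div_of_nonneg_right hx hN₀0.le) hp.le
      have h3 : (t j / τ) ^ (-γ - 1) ≤ N₀ ^ |γ + 1| := by
        rw [← habs]
        exact rpow_le_rpow_abs _ hx hle
      calc (t j / τ) ^ (-γ - 1) ≤ N₀ ^ |γ + 1| := h3
        _ = N₀ ^ (γ + 2 + |γ + 1|) * (N₀ ^ (-γ - 1) * N₀ ^ (-1 : ℝ)) := by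
          rw [← Real.rpow_add hN₀0, ← Real.rpow_add hN₀0]
          congr 1
          ring
        _ ≤ _ := mul_le_mul hA1 (mul_le_mul_of_nonneg_left (h2.trans h1)
            (Real.rpow_nonneg hN₀0.le _)) (by positivity) hA0.le
    · obtain ⟨k, hk1, hk2⟩ := exists_nat_pow_near
        ((one_le_div hN₀0).2 hgt.le) (one_lt_two (α := ℝ))
      have hkn : k ∈ Finset.range (n + 1) := by
        rw [Finset.mem_range]
        have h1 : (2 : ℝ) ^ k < 2 ^ (n + 1) := by
          refine lt_of_le_of_lt (hk1.trans ?_) hn2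
          exact (div_le_self (by linarith) hN₀1).trans
            (div_le_div_of_nonneg_right (ht.le hj hm) hτ.le)
        exact (pow_lt_pow_iff_right₀ one_lt_two).1 h1
      refine le_trans ?_ (hsingle k hkn)
      have hNk0' : 0 < N k := hNk0 k
      rw [le_div_iff₀ hN₀0] at hk1
      rw [div_lt_iff₀ hN₀0, pow_succ] at hk2
      have hy1 : 1 ≤ t j / τ / N k := (one_le_div hNk0').2 (by simp only [N]; linarith)
      have hy2 : t j / τ / N k ≤ 2 := (div_le_iff₀ hNk0').2 (by simp only [N]; linarith)
      set y := t j / τ / N k with hydef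
      have h1 : (1 - α) / 8 ≤
          Real.Gamma (1 - α) * ((τ * N k) ^ α * l1Caputo α t (U (N k)) j) := by
        rcases hy1.eq_or_lt with hy | hy
        · have h2 := (hU (N k) (hNk k) j hj1 hjM).1 hy.ge
          rw [← hydef, ← hy, Real.one_rpow] at h2
          linarith
        · refine le_trans ?_ ((hU (N k) (hNk k) j hj1 hjM).2 hy)
          have h3 : (2 : ℝ) ^ (-2 : ℝ) ≤ y ^ (-α - 1) :=
            (Real.rpow_le_rpow_of_exponent_le one_le_two (by linarith)).trans
              (Real.rpow_le_rpow_of_nonpos (by linarith) hy2 (by linarith))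
          have h4 : (2 : ℝ) ^ (-2 : ℝ) = 1 / 4 := by
            rw [Real.rpow_neg (by norm_num)]
            norm_num
          rw [h4] at h3
          nlinarith
      have h2 : (t j / τ) ^ (-γ - 1) ≤ 2 ^ |γ + 1| * N k ^ (-γ - 1) := by
        have h3 : t j / τ = y * N k := by
          rw [hydef]
          field_simp
        rw [h3, Real.mul_rpow (by linarith) hNk0'.le, ← habs]
        exact mul_le_mul_of_nonneg_right (rpow_le_rpow_abs _ hy1 hy2)
          (Real.rpow_nonneg hNk0'.le _)
      have hNp : 0 ≤ N k ^ (-γ - 1) := Real.rpow_nonneg hNk0'.le _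
      calc (t j / τ) ^ (-γ - 1) ≤ 2 ^ |γ + 1| * N k ^ (-γ - 1) := h2
        _ = 8 * 2 ^ |γ + 1| / (1 - α) * (N k ^ (-γ - 1) * ((1 - α) / 8)) := by
          field_simp
        _ ≤ _ := mul_le_mul hA2 (mul_le_mul_of_nonneg_left h1 hNp) (by positivity) hA0.le
  · have htm : 0 < t m := ht.pos hm1 hm
    have hx0 : 0 < t m / τ := by positivity
    have hterm : ∀ k ∈ Finset.range (n + 1), N k ^ (-γ - 1) * (τ * N k) ^ α * U (N k) m ≤
        τ * t m ^ (α - 1) * (N₀ ^ (-γ) * ((2 : ℝ) ^ k) ^ (-γ)) := by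
      intro k _
      have hNk0' : 0 < N k := hNk0 k
      have ha : 0 < τ * N k := by positivity
      have h1 : U (N k) m ≤ (t m / (τ * N k)) ^ (α - 1) := profile_le_rpow hα1 (by positivity)
      have h2 : (τ * N k) ^ α = τ * N k * (τ * N k) ^ (α - 1) := by
        rw [Real.rpow_sub_one ha.ne']
        field_simp
      have h3 : N k ^ (-γ) = N k ^ (-γ - 1) * N k := by
        rw [Real.rpow_sub_one hNk0'.ne']
        field_simp
      calc _ ≤ N k ^ (-γ - 1) * (τ * N k) ^ α * (t m / (τ * N k)) ^ (α - 1) :=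
            mul_le_mul_of_nonneg_left h1 (by positivity)
        _ = τ * t m ^ (α - 1) * N k ^ (-γ) := by
            have h4 : (τ * N k) ^ (α - 1) ≠ 0 := (Real.rpow_pos_of_pos ha _).ne'
            rw [Real.div_rpow htm.le ha.le, h2, h3]
            field_simp
        _ = _ := by
            rw [← Real.mul_rpow hN₀0.le (by positivity)]
    have hS := (Finset.sum_le_sum hterm)
    rw [← Finset.mul_sum, ← Finset.mul_sum] at hS
    have h5 := hD (t m / τ) n (hx1 m hm1 hm) hn1
    rw [one_div_div] at h5
    have hpre : 0 ≤ τ * t m ^ (α - 1) * N₀ ^ (-γ) := by positivity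
    unfold stabilityMajorant
    have h6 := mul_le_mul_of_nonneg_left h5 hpre
    calc _ ≤ Real.Gamma (1 - α) * A * (τ * t m ^ (α - 1) * N₀ ^ (-γ) *
          (D * (if 0 < γ then 1 else if γ = 0 then 1 + Real.log (t m / τ)
            else (τ / t m) ^ γ))) :=
          mul_le_mul_of_nonneg_left (by linarith) (by positivity)
      _ = _ := by ring

/-- A refinement inherits the upper bound on the steps, since neighbouring nodes of the original
mesh other than `0` and `t 1` are comparable. -/
theorem IsRefinementKeepingFirst.step_le (hr1 : 1 ≤ r) (hc : 0 < c) (ht : IsTemporalMesh T M t)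
    (hstep : ∀ j, 1 ≤ j → j ≤ M → t j - t (j - 1) ≤ c * (t 1 ^ (1 / r) * t j ^ (1 - 1 / r)))
    {M' : ℕ} {t' : ℕ → ℝ} (ht' : IsTemporalMesh T M' t')
    (href : IsRefinementKeepingFirst M t M' t') {k : ℕ} (hk1 : 1 ≤ k) (hk : k ≤ M') :
    t' k - t' (k - 1) ≤ c * max 2 ((2 * c) ^ r) *
      (t' 1 ^ (1 / r) * t' k ^ (1 - 1 / r)) := by
  classical
  have hr0 : 0 < r := by linarith
  have hex : ∃ j, j ≤ M ∧ t' k ≤ t j := ⟨M, le_rfl, by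
    rw [ht.last, ← ht'.last]
    exact ht'.le hk le_rfl⟩
  obtain ⟨hjM, hjk⟩ := Nat.find_spec hex
  have hjmin : ∀ i < Nat.find hex, t i < t' k := fun i hi => by
    have h1 := Nat.find_min hex hi
    push Not at h1
    exact h1 (by omega)
  set j := Nat.find hex with hjdef
  have htk : 0 < t' k := ht'.pos hk1 hk
  have hj1 : 1 ≤ j := by
    by_contra h
    have h1 : j = 0 := by omega
    rw [h1, ht.zero] at hjk
    linarith
  have htj : 0 < t j := ht.pos hj1 hjM
  have hτ : 0 < t 1 := ht.pos le_rfl (by omega)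
  have hprev : t (j - 1) ≤ t' (k - 1) := by
    obtain ⟨l, hl, hlt⟩ := href.subset (j - 1) (by omega)
    have h1 : t' l < t' k := by
      rw [hlt]
      exact hjmin _ (by omega)
    have h2 : l < k := by
      by_contra h
      exact absurd (ht'.le (show k ≤ l by omega) hl) (by linarith)
    rw [← hlt]
    exact ht'.le (by omega) (by omega)
  set D := max 2 ((2 * c) ^ r) with hD
  have hD2 : 2 ≤ D := le_max_left _ _
  have hcomp : t j ≤ D * t' k := by
    rcases Nat.eq_or_lt_of_le hj1 with h1 | h1
    · have h2 : t' 1 ≤ t' k := ht'.le hk1 hk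
      rw [href.first_eq] at h2
      rw [← h1]
      nlinarith
    · have h2 : t 1 ≤ t' k := (hjmin 1 h1).le
      rcases le_or_gt (t j) ((2 * c) ^ r * t 1) with h3 | h3
      · exact h3.trans (mul_le_mul (le_max_right _ _) h2 hτ.le (by linarith))
      · have h4 := hstep j hj1 hjM
        have h5 : 2 * c * t 1 ^ (1 / r) ≤ t j ^ (1 / r) := by
          have h6 := Real.rpow_le_rpow (by positivity) h3.le (show 0 ≤ 1 / r by positivity)
          rwa [Real.mul_rpow (by positivity) hτ.le, ← Real.rpow_mul (by positivity),
            mul_one_div_cancel hr0.ne', Real.rpow_one] at h6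
        have h7 : t j ^ (1 / r) * t j ^ (1 - 1 / r) = t j := by
          rw [← Real.rpow_add htj, add_sub_cancel, Real.rpow_one]
        have h8 : 0 ≤ t j ^ (1 - 1 / r) := Real.rpow_nonneg htj.le _
        have h9 := mul_le_mul_of_nonneg_right h5 h8
        have h10 := hjmin (j - 1) (by omega)
        nlinarith
  have hexp : 0 ≤ 1 - 1 / r := by
    rw [sub_nonneg, div_le_one hr0]
    exact hr1
  have hpow : t j ^ (1 - 1 / r) ≤ D * t' k ^ (1 - 1 / r) := by
    calc t j ^ (1 - 1 / r) ≤ (D * t' k) ^ (1 - 1 / r) := Real.rpow_le_rpow htj.le hcomp hexp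
      _ = D ^ (1 - 1 / r) * t' k ^ (1 - 1 / r) := Real.mul_rpow (by linarith) htk.le
      _ ≤ D * t' k ^ (1 - 1 / r) := by
        refine mul_le_mul_of_nonneg_right ?_ (Real.rpow_nonneg htk.le _)
        have h1 : 0 ≤ 1 / r := by positivity
        simpa using Real.rpow_le_rpow_of_exponent_le (show 1 ≤ D by linarith)
          (show 1 - 1 / r ≤ 1 by linarith)
  rw [href.first_eq]
  calc t' k - t' (k - 1) ≤ t j - t (j - 1) := by linarith
    _ ≤ c * (t 1 ^ (1 / r) * t j ^ (1 - 1 / r)) := hstep j hj1 hjM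
    _ ≤ c * (t 1 ^ (1 / r) * (D * t' k ^ (1 - 1 / r))) := by gcongr
    _ = c * D * (t 1 ^ (1 / r) * t' k ^ (1 - 1 / r)) := by ring

end Graded
/-! ### The stability theorem -/

theorem theorem2p1 (α : ℝ) (hα0 : 0 < α) (hα1 : α < 1) (T : ℝ) (hT : 0 < T) :
    -- quasi-graded meshes
    (∀ γ r c : ℝ, 1 ≤ r → r ≤ (2 - α) / α → 0 < c →
      ∃ C : ℝ, 0 < C ∧ ∀ (M : ℕ) (t : ℕ → ℝ), IsTemporalMesh T M t → IsQuasiGraded r c M t →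
        StabilityProperty α γ C M t ∧ StabilityPropertyAbs α γ C M t) ∧
    -- arbitrary meshes
    (∀ γ : ℝ, γ ≤ α - 1 →
      ∃ C : ℝ, 0 < C ∧ ∀ (M : ℕ) (t : ℕ → ℝ), IsTemporalMesh T M t →
        StabilityProperty α γ C M t ∧ StabilityPropertyAbs α γ C M t) ∧
    -- refinements of quasi-graded meshes
    (∀ γ r c : ℝ, 1 ≤ r → r ≤ (2 - α) / α → 0 < c →
      ∃ C : ℝ, 0 < C ∧ ∀ (M : ℕ) (t : ℕ → ℝ), IsTemporalMesh T M t → IsQuasiGraded r c M t →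
        ∀ (M' : ℕ) (t' : ℕ → ℝ), IsTemporalMesh T M' t' → IsRefinementKeepingFirst M t M' t' →
          StabilityProperty α γ C M' t' ∧ StabilityPropertyAbs α γ C M' t') ∧
    -- meshes subject to the weaker condition
    (∀ γ r c : ℝ, 1 ≤ r → r ≤ (2 - α) / α → 0 < c →
      ∃ C : ℝ, 0 < C ∧ ∀ (M : ℕ) (t : ℕ → ℝ), IsTemporalMesh T M t → IsWeaklyQuasiGraded r c M t →
        StabilityProperty α γ C M t ∧ StabilityPropertyAbs α γ C M t) := by
  refine ⟨fun γ r c hr1 hr2 hc => ?_, fun γ hγ => ?_, fun γ r c hr1 hr2 hc => ?_,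
    fun γ r c hr1 hr2 hc => ?_⟩
  · obtain ⟨C, hC, h⟩ := exists_stability_of_step_le hα0 hα1 γ hr1 hr2 hc
    exact ⟨C, hC, fun M t ht hq => h T M t ht hq.step_le⟩
  · exact ⟨Real.Gamma (1 - α), Real.Gamma_pos_of_pos (by linarith), fun M t ht =>
      stability_of_le hα0 hα1 ht hγ⟩
  · obtain ⟨C, hC, h⟩ := exists_stability_of_step_le hα0 hα1 γ hr1 hr2
      (c := c * max 2 ((2 * c) ^ r)) (by positivity)
    exact ⟨C, hC, fun M t ht hq M' t' ht' href => h T M' t' ht' fun k hk1 hk =>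
      href.step_le hr1 hc ht hq.step_le ht' hk1 hk⟩
  · obtain ⟨C, hC, h⟩ := exists_stability_of_step_le hα0 hα1 γ hr1 hr2 hc
    exact ⟨C, hC, fun M t ht hq => h T M t ht hq.step_le⟩
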